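/- Let $\nu$ be a probability measure supported in $[0,\infty)$ and let $\{\xi_v : v\in\mathbb{Z}^2\}$ be independent random variables with law $\nu$. An upright path is a finite nearest-neighbour path in $\mathbb{Z}^2$ each of whose steps is $(1,0)$ or $(0,1)$; its weight $\ell(\gamma)$ is the sum of $\xi_v$ over the vertices $v$ that it visits. Let $X_{a,b}$ be the maximum weight of an upright path from $(1,1)$ to $(\lfloor a\rfloor,\lfloor b\rfloor)$, and let $\mu=\lim_{r\to\infty} r^{-1}\mathbb{E}[X_{r,r}]$. Assume the following. (1) $\nu(\{0\})=0$ and $\mu<\infty$. (2) There are constants $\rho\in(0,1)$ and $G_1,G_2,g_1,g_2>0$ such that, for all large enough $r\in\mathbb{N}$ and all $x\in[-\rho,\rho]$, $$\mathbb{E}[X_{r(1-x),r(1+x)}]-\mu r\in\big[-G_1x^2r-g_1r^{1/3},\,-G_2x^2r-g_2r^{1/3}\big].$$ (3) For every $\delta>0$ there are constants $c,\theta_0,r_0>0$ such that, for all real $x$ with $|x|\le 1-\delta$, all integers $r>r_0$ and all $\theta>\theta_0$, $$\mathbb{P}\big(X_{r(1+x),r(1-x)}-\mathbb{E}[X_{r(1+x),r(1-x)}]>\theta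 r^{1/3}\big)\le \exp\big(-c\min(\theta^{3/2},\theta r^{1/3})\big),$$ $$\mathbb{P}\big(X_{r(1+x),r(1-x)}-\mathbb{E}[X_{r(1+x),r(1-x)}]<-\theta r^{1/3}\big)\le \exp(-c\theta^{3/2}).$$ For $n\in\mathbb{N}$ and $w\ge 0$ let $U_{n,w}=\{(x,y): 2\le x+y\le 2n,\ |x-y|\le w\}$. Then there is a constant $c>0$ such that for every $C_3>0$ there exist $\delta=\delta(C_3)>0$ and $c_1=c_1(C_3)>0$ with the following property. For all integers $n,k\ge 1$ with $k\le c_1n$, let $\mathcal{E}=\mathcal{E}(n,k,\delta,C_3)$ be the event that there exist $k$ pairwise vertex-disjoint upright paths $\gamma_1,\dots,\gamma_k$ contained in $U_{n,\delta k^{1/3}n^{2/3}}$ such that $\ell(\gamma_i)\ge \mu n-C_3k^{2/3}n^{1/3}$ for $i=1,\dots,k$. Then $$\mathbb{P}(\mathcal{E})\le e^{-ck^2}.$$ The constants $c$, $\delta$, $c_1$ may depend on $\nu$, and $c$ does not depend on $C_3$, $n$ or $k$. -/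

import Mathlib

noncomputable section

namespace LPP

/-- A configuration of vertex weights on the lattice `ℤ²`. -/
abbrev Weights : Type := ℤ × ℤ → ℝ

/-- `v` is reached from `u` by a unit step to the right or upwards. -/
def IsUpStep (u v : ℤ × ℤ) : Prop := v = (u.1 + 1, u.2) ∨ v = (u.1, u.2 + 1)

/-- A (finite, nonempty) upright path in `ℤ²`, with vertices `pt 0, …, pt len`. -/
structure UprightPath where
  len : ℕ
  pt : Fin (len + 1) → ℤ × ℤ
  step : ∀ i : Fin len, IsUpStep (pt i.castSucc) (pt i.succ)

/-- The first vertex of a path. -/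
def UprightPath.start (γ : UprightPath) : ℤ × ℤ := γ.pt 0

/-- The last vertex of a path. -/
def UprightPath.finish (γ : UprightPath) : ℤ × ℤ := γ.pt (Fin.last γ.len)

/-- The set of vertices visited by a path. -/
def UprightPath.verts (γ : UprightPath) : Set (ℤ × ℤ) := Set.range γ.pt

/-- The weight of a path: the sum of the weights of its vertices
(an upright path visits no vertex twice). -/
def UprightPath.weight (ω : Weights) (γ : UprightPath) : ℝ := ∑ i, ω (γ.pt i)

/-- The last passage value `X_{u → v}`: the maximum weight of an upright path from `u` to `v`.
(Finitely many paths compete; there is at least one when `u ≤ v` coordinatewise.) -/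
def lastPassage (u v : ℤ × ℤ) (ω : Weights) : ℝ :=
  sSup {w : ℝ | ∃ γ : UprightPath, γ.start = u ∧ γ.finish = v ∧ γ.weight ω = w}

/-- `X_{a,b}` for real `a`, `b`: the last passage value from `(1,1)` to `(⌊a⌋, ⌊b⌋)`. -/
def passageTo (a b : ℝ) (ω : Weights) : ℝ := lastPassage (1, 1) (⌊a⌋, ⌊b⌋) ω

/-- The law of a field of independent vertex weights, each with distribution `ν`. -/
def fieldLaw (ν : MeasureTheory.Measure ℝ) : MeasureTheory.Measure Weights :=
  MeasureTheory.Measure.infinitePi (fun _ : ℤ × ℤ => ν)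

/-- The mean `E[X_{a,b}]`. -/
def meanPassage (ν : MeasureTheory.Measure ℝ) (a b : ℝ) : ℝ :=
  ∫ ω, passageTo a b ω ∂(fieldLaw ν)

/-- The limit `μ = lim r⁻¹ E[X_{r,r}]` exists and is finite (in particular the means are finite). -/
def HasGrowthRate (ν : MeasureTheory.Measure ℝ) (μ : ℝ) : Prop :=
  (∀ r : ℕ, 1 ≤ r → MeasureTheory.Integrable (passageTo r r) (fieldLaw ν)) ∧
    Filter.Tendsto (fun r : ℕ => (r : ℝ)⁻¹ * meanPassage ν r r) Filter.atTop (nhds μ)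

/-- Strong concavity of the limit shape near the diagonal, and non-random fluctuations. -/
def LimitShapeAssumption (ν : MeasureTheory.Measure ℝ) (μ : ℝ) : Prop :=
  ∃ ρ G₁ G₂ g₁ g₂ : ℝ, 0 < ρ ∧ ρ < 1 ∧ 0 < G₁ ∧ 0 < G₂ ∧ 0 < g₁ ∧ 0 < g₂ ∧
    ∃ r₀ : ℕ, ∀ r : ℕ, r₀ ≤ r → ∀ x ∈ Set.Icc (-ρ) ρ,
      meanPassage ν (r * (1 - x)) (r * (1 + x)) - μ * r ∈
        Set.Icc (-G₁ * x ^ 2 * r - g₁ * (r : ℝ) ^ (1 / 3 : ℝ))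
          (-G₂ * x ^ 2 * r - g₂ * (r : ℝ) ^ (1 / 3 : ℝ))

/-- Moderate and large deviation estimates, uniform in directions away from the axes. -/
def TailAssumption (ν : MeasureTheory.Measure ℝ) : Prop :=
  ∀ δ : ℝ, 0 < δ → ∃ c θ₀ r₀ : ℝ, 0 < c ∧ 0 < θ₀ ∧ 0 < r₀ ∧
    ∀ x : ℝ, |x| ≤ 1 - δ → ∀ r : ℕ, r₀ < r → ∀ θ : ℝ, θ₀ < θ →
      (fieldLaw ν).real {ω | passageTo (r * (1 + x)) (r * (1 - x)) ω
            - meanPassage ν (r * (1 + x)) (r * (1 - x)) > θ * (r : ℝ) ^ (1 / 3 : ℝ)}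
          ≤ Real.exp (-c * min (θ ^ (3 / 2 : ℝ)) (θ * (r : ℝ) ^ (1 / 3 : ℝ))) ∧
      (fieldLaw ν).real {ω | passageTo (r * (1 + x)) (r * (1 - x)) ω
            - meanPassage ν (r * (1 + x)) (r * (1 - x)) < -θ * (r : ℝ) ^ (1 / 3 : ℝ)}
          ≤ Real.exp (-c * θ ^ (3 / 2 : ℝ))

/-- The (lattice points of the) strip `U_{n,w} = {2 ≤ x + y ≤ 2n, |x - y| ≤ w}`. -/
def strip (n : ℕ) (w : ℝ) : Set (ℤ × ℤ) :=
  {p | 2 ≤ p.1 + p.2 ∧ p.1 + p.2 ≤ 2 * (n : ℤ) ∧ |(p.1 : ℝ) - (p.2 : ℝ)| ≤ w}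

/-- The event that there are `k` disjoint upright paths in the strip of width parameter
`δ k^{1/3} n^{2/3}`, each of weight at least `μ n - C₃ k^{2/3} n^{1/3}`. -/
def disjointPathsEvent (μ : ℝ) (n k : ℕ) (δ C₃ : ℝ) : Set Weights :=
  {ω | ∃ γ : Fin k → UprightPath,
    (∀ i j, i ≠ j → Disjoint (γ i).verts (γ j).verts) ∧
    (∀ i, (γ i).verts ⊆ strip n (δ * (k : ℝ) ^ (1 / 3 : ℝ) * (n : ℝ) ^ (2 / 3 : ℝ))) ∧
    (∀ i, μ * n - C₃ * (k : ℝ) ^ (2 / 3 : ℝ) * (n : ℝ) ^ (1 / 3 : ℝ) ≤ (γ i).weight ω)}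

end LPP

end

open MeasureTheory
open scoped ENNReal

noncomputable section

namespace LPP

/-! ### Product measure: resampling, gluing and relabelling of fields -/

section Product

variable (ν : Measure ℝ) [IsProbabilityMeasure ν]

/-! The mean of a diagonal passage time at scale r lies below μr by a multiple of r^{1/3}, and its
fluctuations are of that same order. For λ = s·r^{-1/3} with s a small constant, this deficit,
linear in s, beats the quadratic term of the moment generating function
(`exists_diagonal_mgf_bound`), so E exp(λX) ≤ exp(λμr − c). The deficit survives for the best
crossing of a block of 2r levels between two given intervals of length η r^{2/3}
(`exists_crossing_bound`). Short independent legs extend such crossings to fixed endpoints, at a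
cost controlled by Jensen and the lower bound on means. A passage time of arbitrary slope is then
made diagonal by appending an independent reflected copy, so no upper tail estimate off the diagonal
is needed.

Cut the strip into m = a³k blocks, so that r is about n/m. The k disjoint paths split into at most
km disjoint pieces of crossings. A van den Berg-Kesten type inequality for exponential weights
(`lintegral_expSup_disjointFamilyUnions_le`) bounds the exponential moment of their total weight by
exp(λμnk − ckm). On the event the total weight is at least k(μn − C₃k^{2/3}n^{1/3}), so Markov's
inequality loses a factor exp(sC₃ak²) and gains exp(−ca³k²). A large a, depending on C₃, makes the
gain win, while c depends only on the crossing bound.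

The union bound over end intervals must not destroy this gain. The paths are uncrossed
(`exists_sorted_climbs`), so on each level their cells are monotone in the index. With about εk
cells there are at most e^{ck/4} monotone assignments (`exists_card_monotoneMaps_le_exp`), and the
total entropy is half the gain. The width δ is chosen so that εk cells of length of order r^{2/3}
cover the strip. -/

instance isProbabilityMeasure_fieldLaw : IsProbabilityMeasure (fieldLaw ν) := by
  unfold fieldLaw; infer_instance

theorem measurable_weightAt (v : ℤ × ℤ) : Measurable fun ω : Weights => ω v :=
  measurable_pi_apply v

theorem measurable_piecewise_prod (S : Set (ℤ × ℤ)) [DecidablePred (· ∈ S)] :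
    Measurable (fun p : Weights × Weights => S.piecewise p.1 p.2) := by
  refine measurable_pi_iff.2 fun v => ?_
  by_cases hv : v ∈ S
  · simpa [Set.piecewise, hv, Function.comp_def] using (measurable_weightAt v).comp (measurable_fst (β := Weights))
  · simpa [Set.piecewise, hv, Function.comp_def] using (measurable_weightAt v).comp (measurable_snd (α := Weights))

/-- Gluing two independent fields along a set gives a field with the same law. -/
theorem measurePreserving_piecewise (S : Set (ℤ × ℤ)) [DecidablePred (· ∈ S)] :
    MeasurePreserving (fun p : Weights × Weights => S.piecewise p.1 p.2)
      ((fieldLaw ν).prod (fieldLaw ν)) (fieldLaw ν) := by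
  refine ⟨measurable_piecewise_prod S, ?_⟩
  refine Measure.eq_infinitePi (fun _ => ν) fun s t ht => ?_
  rw [Measure.map_apply (measurable_piecewise_prod S)
    (MeasurableSet.pi s.countable_toSet fun i _ => ht i)]
  have : (fun p : Weights × Weights => S.piecewise p.1 p.2) ⁻¹' (Set.pi s t) =
      (Set.pi (s.filter (· ∈ S)) t) ×ˢ (Set.pi (s.filter (· ∉ S)) t) := by
    ext ⟨a, b⟩
    simp only [Set.mem_preimage, Set.mem_pi, Set.mem_prod, Finset.coe_filter, Set.mem_ofPred_eq,
      Finset.mem_coe, and_imp]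
    constructor
    · intro h
      exact ⟨fun i hi hS => by simpa [hS] using h i hi, fun i hi hS => by simpa [hS] using h i hi⟩
    · rintro ⟨h1, h2⟩ i hi
      by_cases hS : i ∈ S
      · simpa [hS] using h1 i hi hS
      · simpa [hS] using h2 i hi hS
  rw [this, Measure.prod_prod, fieldLaw, Measure.infinitePi_pi _ (fun i _ => ht i),
    Measure.infinitePi_pi _ (fun i _ => ht i), Finset.prod_filter_mul_prod_filter_not]

/-- Resampling one coordinate does not change the law. -/
theorem lintegral_update (v : ℤ × ℤ) {F : Weights → ℝ≥0∞} (hF : Measurable F) :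
    ∫⁻ ω, F ω ∂fieldLaw ν = ∫⁻ ω, ∫⁻ x, F (Function.update ω v x) ∂ν ∂fieldLaw ν := by
  classical
  have hpc := measurable_piecewise_prod ({v}ᶜ : Set (ℤ × ℤ))
  rw [← (measurePreserving_piecewise ν ({v}ᶜ : Set (ℤ × ℤ))).lintegral_comp hF,
    lintegral_prod (fun p : Weights × Weights => F (({v}ᶜ : Set (ℤ × ℤ)).piecewise p.1 p.2))
      (hF.comp hpc).aemeasurable]
  refine lintegral_congr fun ω => ?_
  have hmp : MeasurePreserving (Function.eval v) (fieldLaw ν) ν :=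
    measurePreserving_eval_infinitePi (fun _ => ν) v
  have hm : Measurable fun x => F (Function.update ω v x) :=
    hF.comp (measurable_update ω)
  rw [← hmp.lintegral_comp hm]
  refine lintegral_congr fun ω' => ?_
  congr 1
  ext w
  by_cases hw : w = v
  · subst hw; simp
  · simp [hw]

theorem measurable_update_prod (v : ℤ × ℤ) :
    Measurable (fun p : Weights × ℝ => Function.update p.1 v p.2) := by
  refine measurable_pi_iff.2 fun w => ?_
  by_cases hw : w = v
  · subst hw; simpa using measurable_snd
  · simpa [Function.update_of_ne hw, Function.comp_def] using (measurable_weightAt w).comp (measurable_fst (β := ℝ))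

theorem lintegral_update_update (v : ℤ × ℤ) {F : Weights → Weights → ℝ≥0∞}
    (hF : Measurable (Function.uncurry F)) :
    ∫⁻ ω, ∫⁻ ω', F ω ω' ∂fieldLaw ν ∂fieldLaw ν =
      ∫⁻ ω, ∫⁻ ω', ∫⁻ x, ∫⁻ y, F (Function.update ω v x) (Function.update ω' v y) ∂ν ∂ν
        ∂fieldLaw ν ∂fieldLaw ν := by
  rw [lintegral_update ν v (F := fun ω => ∫⁻ ω', F ω ω' ∂fieldLaw ν) hF.lintegral_prod_right']
  refine lintegral_congr fun ω => ?_
  have h2 : Measurable (Function.uncurry fun (x : ℝ) (ω' : Weights) =>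
      F (Function.update ω v x) ω') :=
    hF.comp (((measurable_update ω).comp measurable_fst).prodMk measurable_snd)
  have h3 : ∀ x, ∫⁻ ω', F (Function.update ω v x) ω' ∂fieldLaw ν =
      ∫⁻ ω', ∫⁻ y, F (Function.update ω v x) (Function.update ω' v y) ∂ν ∂fieldLaw ν := fun x =>
    lintegral_update ν v (hF.comp (measurable_const.prodMk measurable_id))
  calc _ = ∫⁻ x, ∫⁻ ω', ∫⁻ y, F (Function.update ω v x) (Function.update ω' v y) ∂ν
        ∂fieldLaw ν ∂ν := lintegral_congr h3
    _ = _ := by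
      rw [lintegral_lintegral_swap]
      refine Measurable.aemeasurable ?_
      refine Measurable.lintegral_prod_right' (f := fun p : (ℝ × Weights) × ℝ =>
        F (Function.update ω v p.1.1) (Function.update p.1.2 v p.2)) ?_
      exact h2.comp ((measurable_fst.comp measurable_fst).prodMk
        ((measurable_update_prod v).comp
          ((measurable_snd.comp measurable_fst).prodMk measurable_snd)))

/-- The duplication inequality behind the van den Berg-Kesten inequality: if in every coordinate
the diagonal value of `f` is dominated after resampling one of the two copies, then the copies may
be decoupled on any finite set. -/
theorem lintegral_diag_le_piecewise {f : Weights → Weights → ℝ≥0∞}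
    (hf : Measurable (Function.uncurry f))
    (h : ∀ v ω ω',
      (∀ x y, f (Function.update ω v x) (Function.update ω' v x) ≤
        f (Function.update ω v x) (Function.update ω' v y)) ∨
      (∀ x y, f (Function.update ω v x) (Function.update ω' v x) ≤
        f (Function.update ω v y) (Function.update ω' v x)))
    (T : Finset (ℤ × ℤ)) :
    ∫⁻ ω, f ω ω ∂fieldLaw ν ≤
      ∫⁻ ω, ∫⁻ ω', f ω ((T : Set (ℤ × ℤ)).piecewise ω' ω) ∂fieldLaw ν ∂fieldLaw ν := by
  classical
  induction T using Finset.induction with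
  | empty =>
    have : ∀ ω ω' : Weights, ((∅ : Finset (ℤ × ℤ)) : Set (ℤ × ℤ)).piecewise ω' ω = ω := by
      intro ω ω'; ext w; simp [Set.piecewise]
    simp only [this, lintegral_const, measure_univ, mul_one, le_refl]
  | insert v T hv ih =>
    refine ih.trans ?_
    have hm : ∀ (S : Set (ℤ × ℤ)) [DecidablePred (· ∈ S)], Measurable (Function.uncurry fun ω ω' : Weights =>
        f ω (S.piecewise ω' ω)) := fun S _ =>
      hf.comp (measurable_fst.prodMk ((measurable_piecewise_prod S).comp measurable_swap))
    rw [lintegral_update_update ν v (hm (T : Set (ℤ × ℤ))),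
      lintegral_update_update ν v (hm ((insert v T : Finset (ℤ × ℤ)) : Set (ℤ × ℤ)))]
    refine lintegral_mono fun ω => lintegral_mono fun ω' => ?_
    set η := (T : Set (ℤ × ℤ)).piecewise ω' ω with hη
    have e1 : ∀ x y, (T : Set (ℤ × ℤ)).piecewise (Function.update ω' v y)
        (Function.update ω v x) = Function.update η v x := by
      intro x y; ext w
      by_cases hw : w = v
      · subst hw; simp [hv]
      · by_cases hT : w ∈ T <;> simp [hη, hw, hT]
    have e2 : ∀ x y, ((insert v T : Finset (ℤ × ℤ)) : Set (ℤ × ℤ)).piecewise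
        (Function.update ω' v y) (Function.update ω v x) = Function.update η v y := by
      intro x y; ext w
      by_cases hw : w = v
      · subst hw; simp
      · by_cases hT : w ∈ T <;> simp [hη, hw, hT]
    simp only [e1, e2]
    rcases h v ω η with h | h
    · exact lintegral_mono fun x => lintegral_mono fun y => h x y
    -- The values x and y at v are exchangeable, so the second alternative reduces to the first
    -- after exchanging the two integrals.
    · rw [lintegral_lintegral_swap (f := fun x y => f (Function.update ω v x)
        (Function.update η v y))]
      · exact lintegral_mono fun x => lintegral_mono fun y => h x y
      · exact (hf.comp (((measurable_update ω).comp measurable_fst).prodMk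
          ((measurable_update η).comp measurable_snd))).aemeasurable

/-- Two functions of the field on complementary sets of vertices are independent. -/
theorem lintegral_diag_eq (S : Set (ℤ × ℤ)) {f : Weights → Weights → ℝ≥0∞}
    (hf : Measurable (Function.uncurry f))
    (h : ∀ ω₁ ω₂ η₁ η₂ : Weights, (∀ v ∈ S, ω₁ v = η₁ v) → (∀ v ∉ S, ω₂ v = η₂ v) →
      f ω₁ ω₂ = f η₁ η₂) :
    ∫⁻ ω, f ω ω ∂fieldLaw ν = ∫⁻ ω, ∫⁻ ω', f ω ω' ∂fieldLaw ν ∂fieldLaw ν := by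
  classical
  have hd : Measurable fun ω => f ω ω := hf.comp (measurable_id.prodMk measurable_id)
  rw [← (measurePreserving_piecewise ν S).lintegral_comp hd,
    lintegral_prod (fun p : Weights × Weights => f (S.piecewise p.1 p.2) (S.piecewise p.1 p.2))
      (hd.comp (measurable_piecewise_prod S)).aemeasurable]
  refine lintegral_congr fun ω => lintegral_congr fun ω' => ?_
  exact h _ _ _ _ (fun v hv => by simp [hv]) (fun v hv => by simp [hv])

/-- Relabelling the vertices preserves the law of the field. -/
theorem measurePreserving_comp_equiv (e : ℤ × ℤ ≃ ℤ × ℤ) :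
    MeasurePreserving (fun ω : Weights => ω ∘ e) (fieldLaw ν) (fieldLaw ν) := by
  classical
  have hm : Measurable (fun ω : Weights => ω ∘ e) :=
    measurable_pi_iff.2 fun v => measurable_pi_apply (e v)
  refine ⟨hm, Measure.eq_infinitePi (fun _ => ν) fun s t ht => ?_⟩
  rw [Measure.map_apply hm (MeasurableSet.pi s.countable_toSet fun i _ => ht i)]
  have : (fun ω : Weights => ω ∘ e) ⁻¹' (Set.pi s t) =
      Set.pi (s.map e.toEmbedding) (fun i => t (e.symm i)) := by
    ext ω
    simp only [Set.mem_preimage, Set.mem_pi, Finset.mem_coe, Finset.mem_map_equiv]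
    exact ⟨fun h i hi => by simpa using h _ hi, fun h i hi => by simpa using h (e i) (by simpa)⟩
  rw [this, fieldLaw, Measure.infinitePi_pi _ (fun i _ => ht _)]
  simp

end Product

/-! ### Exponential weights of disjoint sets -/

section Disjoint

/-- The maximal exponential weight `exp (lam * ω(B))` over the sets `B` of a class `A`. -/
def expSup (lam : ℝ) (A : Set (Finset (ℤ × ℤ))) (ω : Weights) : ℝ≥0∞ :=
  ⨆ B ∈ A, ∏ v ∈ B, ENNReal.ofReal (Real.exp (lam * ω v))

theorem expWeight_eq (lam : ℝ) (B : Finset (ℤ × ℤ)) (ω : Weights) :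
    ∏ v ∈ B, ENNReal.ofReal (Real.exp (lam * ω v)) =
      ENNReal.ofReal (Real.exp (lam * ∑ v ∈ B, ω v)) := by
  rw [Finset.mul_sum, Real.exp_sum, ENNReal.ofReal_prod_of_nonneg fun _ _ => (Real.exp_pos _).le]

theorem measurable_expWeight (lam : ℝ) (B : Finset (ℤ × ℤ)) :
    Measurable fun ω : Weights => ∏ v ∈ B, ENNReal.ofReal (Real.exp (lam * ω v)) :=
  Finset.measurable_prod _ fun v _ => ENNReal.measurable_ofReal.comp
    (Real.measurable_exp.comp ((measurable_weightAt v).const_mul lam))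

theorem measurable_expSup (lam : ℝ) (A : Set (Finset (ℤ × ℤ))) : Measurable (expSup lam A) :=
  Measurable.biSup _ A.to_countable fun B _ => measurable_expWeight lam B

theorem le_expSup {lam : ℝ} {A : Set (Finset (ℤ × ℤ))} {B : Finset (ℤ × ℤ)} (hB : B ∈ A)
    (ω : Weights) : ∏ v ∈ B, ENNReal.ofReal (Real.exp (lam * ω v)) ≤ expSup lam A ω :=
  le_iSup₂ (f := fun (B : Finset (ℤ × ℤ)) (_ : B ∈ A) =>
    ∏ v ∈ B, ENNReal.ofReal (Real.exp (lam * ω v))) B hB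

/-- The unions of two disjoint sets taken from two classes. -/
def disjointUnions (A A' : Set (Finset (ℤ × ℤ))) : Set (Finset (ℤ × ℤ)) :=
  {C | ∃ B ∈ A, ∃ B' ∈ A', Disjoint B B' ∧ C = B ∪ B'}

theorem prod_update_of_notMem {B : Finset (ℤ × ℤ)} {v : ℤ × ℤ} (hv : v ∉ B) (lam : ℝ)
    (ω : Weights) (x : ℝ) :
    ∏ w ∈ B, ENNReal.ofReal (Real.exp (lam * Function.update ω v x w)) =
      ∏ w ∈ B, ENNReal.ofReal (Real.exp (lam * ω w)) := by
  refine Finset.prod_congr rfl fun w hw => ?_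
  rw [Function.update_of_ne (ne_of_mem_of_not_mem hw hv)]

theorem prod_update_of_mem {B : Finset (ℤ × ℤ)} {v : ℤ × ℤ} (hv : v ∈ B) (lam : ℝ)
    (ω : Weights) (x : ℝ) :
    ∏ w ∈ B, ENNReal.ofReal (Real.exp (lam * Function.update ω v x w)) =
      ENNReal.ofReal (Real.exp (lam * x)) *
        ∏ w ∈ B.erase v, ENNReal.ofReal (Real.exp (lam * ω w)) := by
  rw [← Finset.mul_prod_erase _ _ hv, prod_update_of_notMem (Finset.notMem_erase v B)]
  simp

/-- An inequality of van den Berg-Kesten type for exponential weights of disjoint sets. -/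
theorem lintegral_expSup_disjointUnions_le (ν : Measure ℝ) [IsProbabilityMeasure ν] (lam : ℝ)
    (A A' : Set (Finset (ℤ × ℤ))) (T : Finset (ℤ × ℤ)) (hT : ∀ B ∈ A', B ⊆ T) :
    ∫⁻ ω, expSup lam (disjointUnions A A') ω ∂fieldLaw ν ≤
      (∫⁻ ω, expSup lam A ω ∂fieldLaw ν) * ∫⁻ ω, expSup lam A' ω ∂fieldLaw ν := by
  classical
  set φ : Finset (ℤ × ℤ) → Weights → ℝ≥0∞ := fun B ω =>
    ∏ v ∈ B, ENNReal.ofReal (Real.exp (lam * ω v)) with hφ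
  set D : Set (Finset (ℤ × ℤ) × Finset (ℤ × ℤ)) := {p | p.1 ∈ A ∧ p.2 ∈ A' ∧ Disjoint p.1 p.2}
  set f : Weights → Weights → ℝ≥0∞ := fun ω ω' => ⨆ p ∈ D, φ p.1 ω * φ p.2 ω' with hfdef
  have hfm : Measurable (Function.uncurry f) :=
    Measurable.biSup _ D.to_countable fun p _ =>
      ((measurable_expWeight lam p.1).comp measurable_fst).mul
        ((measurable_expWeight lam p.2).comp measurable_snd)
  have hle : ∀ p ∈ D, ∀ ω ω', φ p.1 ω * φ p.2 ω' ≤ f ω ω' := fun p hp ω ω' =>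
    le_iSup₂ (f := fun (p : Finset (ℤ × ℤ) × Finset (ℤ × ℤ)) (_ : p ∈ D) => φ p.1 ω * φ p.2 ω')
      p hp
  have key := lintegral_diag_le_piecewise ν hfm ?_ T
  · calc ∫⁻ ω, expSup lam (disjointUnions A A') ω ∂fieldLaw ν
        ≤ ∫⁻ ω, f ω ω ∂fieldLaw ν := by
          refine lintegral_mono fun ω => iSup₂_le ?_
          rintro C ⟨B, hB, B', hB', hd, rfl⟩
          rw [Finset.prod_union hd]
          exact hle (B, B') ⟨hB, hB', hd⟩ ω ω
      _ ≤ _ := key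
      _ ≤ ∫⁻ ω, ∫⁻ ω', expSup lam A ω * expSup lam A' ω' ∂fieldLaw ν ∂fieldLaw ν := by
          refine lintegral_mono fun ω => lintegral_mono fun ω' => iSup₂_le ?_
          rintro ⟨B, B'⟩ ⟨hB, hB', hd⟩
          refine mul_le_mul' (le_expSup hB ω) (le_trans (le_of_eq ?_) (le_expSup hB' ω'))
          refine Finset.prod_congr rfl fun w hw => ?_
          -- Decoupling on T suffices: every set of A' lies in T, where the glued field is the
          -- independent copy.
          rw [Set.piecewise_eq_of_mem _ _ _ (Finset.mem_coe.2 (hT B' hB' hw))]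
      _ = _ := by
          simp_rw [lintegral_const_mul _ (measurable_expSup lam A')]
          rw [lintegral_mul_const _ (measurable_expSup lam A)]
  · intro v ω ω'
    set u : ℝ → ℝ≥0∞ := fun x => ENNReal.ofReal (Real.exp (lam * x))
    set β := ⨆ p ∈ {p ∈ D | v ∈ p.1}, φ (p.1.erase v) ω * φ p.2 ω' with hβ
    set γ := ⨆ p ∈ {p ∈ D | v ∈ p.2}, φ p.1 ω * φ (p.2.erase v) ω' with hγ
    have hβle : ∀ p ∈ D, v ∈ p.1 → φ (p.1.erase v) ω * φ p.2 ω' ≤ β := fun p hp hv =>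
      le_iSup₂ (f := fun (p : Finset (ℤ × ℤ) × Finset (ℤ × ℤ)) (_ : p ∈ {p ∈ D | v ∈ p.1}) =>
        φ (p.1.erase v) ω * φ p.2 ω') p ⟨hp, hv⟩
    have hγle : ∀ p ∈ D, v ∈ p.2 → φ p.1 ω * φ (p.2.erase v) ω' ≤ γ := fun p hp hv =>
      le_iSup₂ (f := fun (p : Finset (ℤ × ℤ) × Finset (ℤ × ℤ)) (_ : p ∈ {p ∈ D | v ∈ p.2}) =>
        φ p.1 ω * φ (p.2.erase v) ω') p ⟨hp, hv⟩
    have v1 : ∀ p ∈ D, v ∈ p.1 → ∀ x y,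
        φ p.1 (Function.update ω v x) * φ p.2 (Function.update ω' v y) =
          u x * (φ (p.1.erase v) ω * φ p.2 ω') := fun p hp hv x y => by
      simp only [hφ]
      rw [prod_update_of_mem hv, prod_update_of_notMem (Finset.disjoint_left.1 hp.2.2 hv), mul_assoc]
    have v2 : ∀ p ∈ D, v ∈ p.2 → ∀ x y,
        φ p.1 (Function.update ω v x) * φ p.2 (Function.update ω' v y) =
          u y * (φ p.1 ω * φ (p.2.erase v) ω') := fun p hp hv x y => by
      simp only [hφ]
      rw [prod_update_of_mem hv, prod_update_of_notMem (Finset.disjoint_right.1 hp.2.2 hv)]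
      ring
    have v0 : ∀ p ∈ D, v ∉ p.1 → v ∉ p.2 → ∀ x y x' y',
        φ p.1 (Function.update ω v x) * φ p.2 (Function.update ω' v y) ≤
          f (Function.update ω v x') (Function.update ω' v y') := fun p hp h1 h2 x y x' y' => by
      refine le_trans (le_of_eq ?_) (hle p hp _ _)
      simp only [hφ]
      rw [prod_update_of_notMem h1, prod_update_of_notMem h2, prod_update_of_notMem h1,
        prod_update_of_notMem h2]
    have fβ : ∀ x y, u x * β ≤ f (Function.update ω v x) (Function.update ω' v y) := by
      intro x y
      rw [hβ]
      simp_rw [ENNReal.mul_iSup]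
      refine iSup₂_le fun p hp => ?_
      rw [← v1 p hp.1 hp.2 x y]
      exact hle p hp.1 _ _
    have fγ : ∀ x y, u y * γ ≤ f (Function.update ω v x) (Function.update ω' v y) := by
      intro x y
      rw [hγ]
      simp_rw [ENNReal.mul_iSup]
      refine iSup₂_le fun p hp => ?_
      rw [← v2 p hp.1 hp.2 x y]
      exact hle p hp.1 _ _
    -- By disjointness v lies in at most one set of a pair, so with values x, y at v the function is
    -- the maximum of u(x)β, u(y)γ and a term free of both. On the diagonal x = y the larger of β
    -- and γ wins; the copy carrying that coefficient keeps x and the other is resampled.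
    rcases le_total γ β with hc | hc
    · refine Or.inl fun x y => iSup₂_le fun p hp => ?_
      by_cases h1 : v ∈ p.1
      · rw [v1 p hp h1]
        exact (mul_le_mul_right (hβle p hp h1) _).trans (fβ x y)
      by_cases h2 : v ∈ p.2
      · rw [v2 p hp h2]
        exact (mul_le_mul_right ((hγle p hp h2).trans hc) _).trans (fβ x y)
      · exact v0 p hp h1 h2 _ _ _ _
    · refine Or.inr fun x y => iSup₂_le fun p hp => ?_
      by_cases h1 : v ∈ p.1
      · rw [v1 p hp h1]
        exact (mul_le_mul_right ((hβle p hp h1).trans hc) _).trans (fγ y x)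
      by_cases h2 : v ∈ p.2
      · rw [v2 p hp h2]
        exact (mul_le_mul_right (hγle p hp h2) _).trans (fγ y x)
      · exact v0 p hp h1 h2 _ _ _ _

/-- The unions of pairwise disjoint sets, one from each class of a finite family. -/
def disjointFamilyUnions {ι : Type*} (s : Finset ι) (A : ι → Set (Finset (ℤ × ℤ))) :
    Set (Finset (ℤ × ℤ)) :=
  {C | ∃ b : ι → Finset (ℤ × ℤ), (∀ i ∈ s, b i ∈ A i) ∧
    (∀ i ∈ s, ∀ j ∈ s, i ≠ j → Disjoint (b i) (b j)) ∧ C = s.biUnion b}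

/-- The two-class inequality is iterated, one class being split off at each step. The finite bound T
may depend on the class, since only the class split off is decoupled. -/
theorem lintegral_expSup_disjointFamilyUnions_le (ν : Measure ℝ) [IsProbabilityMeasure ν]
    (lam : ℝ) {ι : Type*} (s : Finset ι) (A : ι → Set (Finset (ℤ × ℤ)))
    (hT : ∀ i, ∃ T : Finset (ℤ × ℤ), ∀ B ∈ A i, B ⊆ T) :
    ∫⁻ ω, expSup lam (disjointFamilyUnions s A) ω ∂fieldLaw ν ≤
      ∏ i ∈ s, ∫⁻ ω, expSup lam (A i) ω ∂fieldLaw ν := by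
  classical
  induction s using Finset.induction with
  | empty =>
    have h1 : ∀ ω, expSup lam (disjointFamilyUnions ∅ A) ω ≤ 1 := fun ω => by
      refine iSup₂_le ?_
      rintro C ⟨b, -, -, rfl⟩
      simp
    calc _ ≤ ∫⁻ _, 1 ∂fieldLaw ν := lintegral_mono h1
      _ = _ := by simp
  | insert i s hi ih =>
    obtain ⟨T, hT'⟩ := hT i
    rw [Finset.prod_insert hi, mul_comm]
    refine le_trans (lintegral_mono fun ω => ?_)
      ((lintegral_expSup_disjointUnions_le ν lam (disjointFamilyUnions s A) (A i) T hT').trans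
        (mul_le_mul_left ih _))
    refine iSup₂_le ?_
    rintro C ⟨b, hb, hd, rfl⟩
    refine le_expSup (A := disjointUnions (disjointFamilyUnions s A) (A i)) ⟨s.biUnion b, ⟨b, fun j hj => hb j (Finset.mem_insert_of_mem hj),
      fun j hj l hl => hd j (Finset.mem_insert_of_mem hj) l (Finset.mem_insert_of_mem hl), rfl⟩,
      b i, hb i (Finset.mem_insert_self _ _), ?_, ?_⟩ ω
    · rw [Finset.disjoint_biUnion_left]
      exact fun j hj => hd j (Finset.mem_insert_of_mem hj) i (Finset.mem_insert_self _ _)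
        (ne_of_mem_of_not_mem hj hi)
    · rw [Finset.biUnion_insert, Finset.union_comm]

end Disjoint

/-! ### Paths as height functions; last passage times -/

section Climb

/-- A height function of a bi-infinite upright path, parametrized by the level `x + y`. -/
def IsClimb (g : ℤ → ℤ) : Prop := ∀ t, g (t + 1) = g t ∨ g (t + 1) = g t + 1

/-- The vertex at level `t` of the path described by `g`. -/
def site (g : ℤ → ℤ) (t : ℤ) : ℤ × ℤ := (g t, t - g t)

/-- The vertices on the levels from `s` to `e` of the path described by `g`. -/
def trace (g : ℤ → ℤ) (s e : ℤ) : Finset (ℤ × ℤ) := (Finset.Icc s e).image (site g)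

theorem site_level (g : ℤ → ℤ) (t : ℤ) : (site g t).1 + (site g t).2 = t := by simp [site]

theorem site_injective (g : ℤ → ℤ) : Function.Injective (site g) := fun a b h => by
  rw [← site_level g a, h, site_level]

theorem mem_trace {g : ℤ → ℤ} {s e : ℤ} {v : ℤ × ℤ} :
    v ∈ trace g s e ↔ s ≤ v.1 + v.2 ∧ v.1 + v.2 ≤ e ∧ v.1 = g (v.1 + v.2) := by
  simp only [trace, Finset.mem_image, Finset.mem_Icc]
  constructor
  · rintro ⟨t, ht, rfl⟩
    rw [site_level]
    exact ⟨ht.1, ht.2, rfl⟩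
  · rintro ⟨h1, h2, h3⟩
    refine ⟨_, ⟨h1, h2⟩, Prod.ext h3.symm ?_⟩
    simp only [site]; omega

theorem sum_trace (g : ℤ → ℤ) (s e : ℤ) (ω : Weights) :
    ∑ v ∈ trace g s e, ω v = ∑ t ∈ Finset.Icc s e, ω (site g t) :=
  Finset.sum_image fun _ _ _ _ h => site_injective g h

theorem IsClimb.le_of_le {g : ℤ → ℤ} (hg : IsClimb g) {s t : ℤ} (h : s ≤ t) :
    g s ≤ g t ∧ g t ≤ g s + (t - s) := by
  induction t, h using Int.leInduction with
  | base => simp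
  | succ t _ ih => rcases hg t with h | h <;> omega

/-- Replacing a climb beyond a level by another climb whose value there is the same or one more. -/
theorem IsClimb.glue {g g' : ℤ → ℤ} (hg : IsClimb g) (hg' : IsClimb g') {s : ℤ}
    (h : g' (s + 1) = g s ∨ g' (s + 1) = g s + 1) :
    IsClimb (fun t => if t ≤ s then g t else g' t) := by
  intro t
  rcases lt_trichotomy t s with h1 | h1 | h1
  · simpa [show t + 1 ≤ s by omega, h1.le] using hg t
  · subst h1; simpa using h
  · simpa [show ¬ t + 1 ≤ s by omega, show ¬ t ≤ s by omega] using hg' t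

/-- The competing paths need not share their first and last levels, but sorting them requires
positions on every level. Beyond its ends the path is therefore prolonged by alternating steps,
which keep 2g(t) − t within 1 of its value at the end vertex. The last clause records this: the
extension stays in the strip widened by 1. -/
theorem UprightPath.exists_climb (γ : UprightPath) :
    ∃ (g : ℤ → ℤ) (s e : ℤ), IsClimb g ∧ s ≤ e ∧ γ.start = site g s ∧ γ.finish = site g e ∧
      γ.verts = (trace g s e : Set (ℤ × ℤ)) ∧
      (∀ ω, γ.weight ω = ∑ v ∈ trace g s e, ω v) ∧
      ∀ t, ∃ t', s ≤ t' ∧ t' ≤ e ∧ |(2 * g t - t) - (2 * g t' - t')| ≤ 1 := by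
  set q : ℕ → ℤ × ℤ := fun i => γ.pt ⟨min i γ.len, by omega⟩ with hq
  have hstep : ∀ i < γ.len, IsUpStep (q i) (q (i + 1)) := by
    intro i hi
    have := γ.step ⟨i, hi⟩
    simp only [hq]
    have e1 : (⟨min i γ.len, by omega⟩ : Fin (γ.len + 1)) = (⟨i, hi⟩ : Fin γ.len).castSucc := by
      ext; simp only [Fin.val_castSucc]; omega
    have e2 : (⟨min (i + 1) γ.len, by omega⟩ : Fin (γ.len + 1)) = (⟨i, hi⟩ : Fin γ.len).succ := by
      ext; simp only [Fin.val_succ]; omega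
    rw [e1, e2]; exact this
  set s : ℤ := (q 0).1 + (q 0).2 with hs
  have hlev : ∀ i ≤ γ.len, (q i).1 + (q i).2 = s + i := by
    intro i
    induction i with
    | zero => intro _; simp [hs]
    | succ i ih =>
      intro hi
      have h1 := ih (by omega)
      rcases hstep i (by omega) with h | h <;> rw [h] <;> push_cast <;> omega
  set e : ℤ := s + γ.len with he
  -- Floor division by 2 produces the alternating steps on both sides.
  set g : ℤ → ℤ := fun t => if t < s then (q 0).1 + (t - s) / 2 else
    if t ≤ e then (q (t - s).toNat).1 else (q γ.len).1 + (t - e) / 2 with hg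
  have gin : ∀ i ≤ γ.len, site g (s + i) = q i := by
    intro i hi
    have h1 : ¬ (s + i : ℤ) < s := by omega
    have h2 : (s + i : ℤ) ≤ e := by omega
    have := hlev i hi
    refine Prod.ext ?_ ?_ <;> simp only [site, hg, h1, h2, if_true, if_false] <;> simp
    omega
  have gv : ∀ i ≤ γ.len, g (s + i) = (q i).1 := fun i hi => congrArg Prod.fst (gin i hi)
  have glow : ∀ t ≤ s, g t = (q 0).1 + (t - s) / 2 := by
    intro t ht
    rcases ht.lt_or_eq with h | h
    · simp [hg, h]
    · have := gv 0 (by omega)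
      subst h; simpa using this
  have ghigh : ∀ t, e ≤ t → g t = (q γ.len).1 + (t - e) / 2 := by
    intro t ht
    rcases ht.lt_or_eq with h | h
    · simp only [hg]; rw [if_neg (by omega), if_neg (by omega)]
    · have := gv γ.len le_rfl
      rw [← he, h] at this
      simpa [h] using this
  have hptq : ∀ i : Fin (γ.len + 1), γ.pt i = q i := by
    intro i
    simp only [hq]
    congr 1; ext; simp; omega
  refine ⟨g, s, e, ?_, by omega, ?_, ?_, ?_, ?_, ?_⟩
  · intro t
    rcases lt_or_ge t s with h | h
    · rw [glow t h.le, glow (t + 1) (by omega)]; omega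
    rcases lt_or_ge t e with h' | h'
    · obtain ⟨i, rfl⟩ : ∃ i : ℕ, t = s + i := ⟨(t - s).toNat, by omega⟩
      have h1 := gv (i + 1) (by omega)
      rw [gv i (by omega), add_assoc, ← Nat.cast_succ, h1]
      rcases hstep i (by omega) with h | h <;> rw [h] <;> simp
    · rw [ghigh t h', ghigh (t + 1) (by omega)]; omega
  · have := gin 0 (by omega)
    simp only [Nat.cast_zero, add_zero] at this
    rw [this]; exact hptq 0
  · rw [he, gin _ le_rfl]; exact hptq (Fin.last _)
  · ext v
    simp only [UprightPath.verts, Set.mem_range, trace, Finset.coe_image, Set.mem_image,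
      Finset.mem_coe, Finset.mem_Icc]
    constructor
    · rintro ⟨i, rfl⟩
      exact ⟨s + i, by omega, by rw [gin _ (by omega), hptq]⟩
    · rintro ⟨t, ht, rfl⟩
      refine ⟨⟨(t - s).toNat, by omega⟩, ?_⟩
      rw [hptq, ← gin _ (by simp; omega)]
      congr 1; simp; omega
  · intro ω
    rw [sum_trace, UprightPath.weight]
    refine Finset.sum_bij (fun (i : Fin (γ.len + 1)) _ => s + (i : ℤ)) ?_ ?_ ?_ ?_
    · intro i _; simp only [Finset.mem_Icc]; omega
    · intro i _ j _ h; ext; omega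
    · intro t ht
      simp only [Finset.mem_Icc] at ht
      exact ⟨⟨(t - s).toNat, by omega⟩, Finset.mem_univ _, by simp; omega⟩
    · intro i _; rw [gin _ (by omega), hptq]
  · intro t
    rcases lt_or_ge t s with h | h
    · refine ⟨s, le_rfl, by omega, ?_⟩
      rw [glow t h.le, glow s le_rfl, abs_le]; omega
    rcases le_or_gt t e with h' | h'
    · exact ⟨t, h, h', by simp⟩
    · refine ⟨e, by omega, le_rfl, ?_⟩
      rw [ghigh t h'.le, ghigh e le_rfl, abs_le]; omega

theorem IsClimb.exists_uprightPath {g : ℤ → ℤ} (hg : IsClimb g) {s e : ℤ} (h : s ≤ e) :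
    ∃ γ : UprightPath, γ.start = site g s ∧ γ.finish = site g e ∧
      ∀ ω, γ.weight ω = ∑ v ∈ trace g s e, ω v := by
  refine ⟨⟨(e - s).toNat, fun i => site g (s + i), fun i => ?_⟩, ?_, ?_, fun ω => ?_⟩
  · have := hg (s + i)
    simp only [IsUpStep, site, Fin.val_castSucc, Fin.val_succ, Nat.cast_add, Nat.cast_one,
      Prod.mk.injEq, ← add_assoc]
    omega
  · simp [UprightPath.start]
  · simp only [UprightPath.finish, Fin.val_last]
    congr 1; omega
  · rw [sum_trace, UprightPath.weight]
    refine Finset.sum_bij (fun (i : Fin ((e - s).toNat + 1)) _ => s + (i : ℤ)) ?_ ?_ ?_ ?_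
    · intro i _; simp only [Finset.mem_Icc]; omega
    · intro i _ j _ h; ext; omega
    · intro t ht
      simp only [Finset.mem_Icc] at ht
      exact ⟨⟨(t - s).toNat, Nat.lt_succ_of_le (show _ ≤ (e - s).toNat by omega)⟩, Finset.mem_univ _, by simp; omega⟩
    · intro i _; rfl

theorem setOf_weights_eq (u v : ℤ × ℤ) (ω : Weights) :
    {w : ℝ | ∃ γ : UprightPath, γ.start = u ∧ γ.finish = v ∧ γ.weight ω = w} =
      {w : ℝ | ∃ (g : ℤ → ℤ) (s e : ℤ), IsClimb g ∧ s ≤ e ∧ site g s = u ∧ site g e = v ∧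
        ∑ z ∈ trace g s e, ω z = w} := by
  ext w
  constructor
  · rintro ⟨γ, rfl, rfl, rfl⟩
    obtain ⟨g, s, e, hg, hse, h1, h2, -, h3, -⟩ := γ.exists_climb
    exact ⟨g, s, e, hg, hse, h1.symm, h2.symm, (h3 ω).symm⟩
  · rintro ⟨g, s, e, hg, hse, rfl, rfl, rfl⟩
    obtain ⟨γ, h1, h2, h3⟩ := hg.exists_uprightPath hse
    exact ⟨γ, h1, h2, h3 ω⟩

theorem finite_weights (u v : ℤ × ℤ) (ω : Weights) :
    {w : ℝ | ∃ γ : UprightPath, γ.start = u ∧ γ.finish = v ∧ γ.weight ω = w}.Finite := by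
  rw [setOf_weights_eq]
  refine ((Finset.finite_toSet (Finset.powerset (Finset.Icc u v))).image
    (fun B => ∑ z ∈ B, ω z)).subset ?_
  rintro w ⟨g, s, e, hg, hse, rfl, rfl, rfl⟩
  refine ⟨trace g s e, ?_, rfl⟩
  simp only [Finset.coe_powerset, Set.mem_preimage, Set.mem_powerset_iff, Finset.coe_subset]
  intro z hz
  obtain ⟨h1, h2, h3⟩ := mem_trace.1 hz
  have a1 := hg.le_of_le h1
  have a2 := hg.le_of_le h2
  simp only [Finset.mem_Icc, site, Prod.le_def]
  omega

theorem IsClimb.sum_le_lastPassage {g : ℤ → ℤ} (hg : IsClimb g) {s e : ℤ} (h : s ≤ e)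
    (ω : Weights) : ∑ z ∈ trace g s e, ω z ≤ lastPassage (site g s) (site g e) ω := by
  refine le_csSup (finite_weights _ _ ω).bddAbove ?_
  rw [setOf_weights_eq]
  exact ⟨g, s, e, hg, h, rfl, rfl, rfl⟩

theorem exists_climb_of_le {u v : ℤ × ℤ} (h : u ≤ v) :
    ∃ g, IsClimb g ∧ site g (u.1 + u.2) = u ∧ site g (v.1 + v.2) = v := by
  obtain ⟨h1, h2⟩ := Prod.le_def.1 h
  -- Between u and v this path goes right first and then up.
  refine ⟨fun t => max u.1 (min v.1 (t - u.2)), fun t => ?_, ?_, ?_⟩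
  · simp only []; omega
  · refine Prod.ext ?_ ?_ <;> simp only [site] <;> omega
  · refine Prod.ext ?_ ?_ <;> simp only [site] <;> omega

theorem exists_climb_lastPassage {u v : ℤ × ℤ} (h : u ≤ v) (ω : Weights) :
    ∃ g, IsClimb g ∧ site g (u.1 + u.2) = u ∧ site g (v.1 + v.2) = v ∧
      lastPassage u v ω = ∑ z ∈ trace g (u.1 + u.2) (v.1 + v.2), ω z := by
  have hne : {w : ℝ | ∃ γ : UprightPath, γ.start = u ∧ γ.finish = v ∧ γ.weight ω = w}.Nonempty := by
    obtain ⟨g, hg, h1, h2⟩ := exists_climb_of_le h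
    have h3 := Prod.le_def.1 h
    obtain ⟨γ, h4, h5, -⟩ := hg.exists_uprightPath (s := u.1 + u.2) (e := v.1 + v.2) (by omega)
    exact ⟨_, γ, h4.trans h1, h5.trans h2, rfl⟩
  have hm := hne.csSup_mem (finite_weights u v ω)
  rw [setOf_weights_eq] at hm
  obtain ⟨g, s, e, hg, hse, rfl, rfl, hw⟩ := hm
  refine ⟨g, hg, ?_⟩
  rw [site_level, site_level]
  exact ⟨rfl, rfl, by rw [hw, ← setOf_weights_eq]; rfl⟩

instance : Countable UprightPath := by
  have : Function.Injective (fun γ : UprightPath =>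
      (⟨γ.len, γ.pt⟩ : Σ n : ℕ, Fin (n + 1) → ℤ × ℤ)) := by
    rintro ⟨a, b, _⟩ ⟨c, d, _⟩ h
    simp only [Sigma.mk.injEq] at h
    obtain ⟨rfl, h⟩ := h
    cases h; rfl
  exact this.countable

theorem measurable_lastPassage (u v : ℤ × ℤ) : Measurable (lastPassage u v) := by
  have : lastPassage u v = fun ω =>
      ⨆ γ : {γ : UprightPath // γ.start = u ∧ γ.finish = v}, γ.1.weight ω := by
    funext ω
    rw [lastPassage, iSup]
    congr 1
    ext w
    simp [and_assoc]
  rw [this]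
  refine Measurable.iSup fun γ => ?_
  exact Finset.measurable_sum _ fun i _ => measurable_weightAt _

theorem lastPassage_nonneg (u v : ℤ × ℤ) {ω : Weights} (hω : ∀ z, 0 ≤ ω z) :
    0 ≤ lastPassage u v ω :=
  Real.sSup_nonneg (by rintro w ⟨γ, -, -, rfl⟩; exact Finset.sum_nonneg fun i _ => hω _)

/-- A path from u to v meets only the levels between them. This is what makes passage times over
disjoint ranges of levels independent. -/
theorem lastPassage_congr {u v : ℤ × ℤ} {ω η : Weights}
    (h : ∀ z, u.1 + u.2 ≤ z.1 + z.2 → z.1 + z.2 ≤ v.1 + v.2 → ω z = η z) :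
    lastPassage u v ω = lastPassage u v η := by
  rw [lastPassage, lastPassage, setOf_weights_eq, setOf_weights_eq]
  congr 1
  ext w
  have : ∀ (g : ℤ → ℤ) (s e : ℤ), site g s = u → site g e = v →
      ∑ z ∈ trace g s e, ω z = ∑ z ∈ trace g s e, η z := by
    rintro g s e rfl rfl
    simp only [site_level] at h
    exact Finset.sum_congr rfl fun z hz => h z (mem_trace.1 hz).1 (mem_trace.1 hz).2.1
  constructor <;> rintro ⟨g, s, e, hg, hse, h1, h2, h3⟩
  · exact ⟨g, s, e, hg, hse, h1, h2, by rw [← h3, this g s e h1 h2]⟩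
  · exact ⟨g, s, e, hg, hse, h1, h2, by rw [← h3, this g s e h1 h2]⟩

theorem lastPassage_translate (u v a : ℤ × ℤ) (ω : Weights) :
    lastPassage (u + a) (v + a) ω = lastPassage u v (ω ∘ Equiv.addRight a) := by
  rw [lastPassage, lastPassage, setOf_weights_eq, setOf_weights_eq]
  congr 1
  ext w
  have key : ∀ (g : ℤ → ℤ) (b : ℤ × ℤ) (s e : ℤ) (η : Weights), IsClimb g →
      ∃ g', IsClimb g' ∧ (∀ t, site g' (t + (b.1 + b.2)) = site g t + b) ∧
        ∑ z ∈ trace g' (s + (b.1 + b.2)) (e + (b.1 + b.2)), η z =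
          ∑ z ∈ trace g s e, η (z + b) := by
    intro g b s e η hg
    refine ⟨fun t => g (t - (b.1 + b.2)) + b.1, fun t => ?_, fun t => ?_, ?_⟩
    · have := hg (t - (b.1 + b.2))
      simp only [show t + 1 - (b.1 + b.2) = t - (b.1 + b.2) + 1 by ring]
      omega
    · refine Prod.ext ?_ ?_ <;> simp [site]; ring
    · rw [sum_trace, sum_trace (ω := fun z => η (z + b)),
        ← Finset.image_add_right_Icc, Finset.sum_image (fun _ _ _ _ h => by simpa using h)]
      refine Finset.sum_congr rfl fun t _ => ?_
      congr 1
      refine Prod.ext ?_ ?_ <;> simp [site]; ring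
  constructor
  · rintro ⟨g, s, e, hg, hse, h1, h2, h3⟩
    obtain ⟨g', hg', h4, h5⟩ := key g (-a) s e (ω ∘ Equiv.addRight a) hg
    refine ⟨g', _, _, hg', by omega, ?_, ?_, h5.trans ?_⟩
    · rw [h4, h1]; simp
    · rw [h4, h2]; simp
    · simpa using h3
  · rintro ⟨g, s, e, hg, hse, h1, h2, h3⟩
    obtain ⟨g', hg', h4, h5⟩ := key g a s e ω hg
    refine ⟨g', _, _, hg', by omega, ?_, ?_, h5.trans ?_⟩
    · rw [h4, h1]
    · rw [h4, h2]
    · simpa using h3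

theorem lastPassage_swap (u v : ℤ × ℤ) (ω : Weights) :
    lastPassage u.swap v.swap ω = lastPassage u v (ω ∘ Equiv.prodComm ℤ ℤ) := by
  rw [lastPassage, lastPassage, setOf_weights_eq, setOf_weights_eq]
  congr 1
  ext w
  have key : ∀ (g : ℤ → ℤ) (s e : ℤ) (η : Weights), IsClimb g →
      ∃ g', IsClimb g' ∧ (∀ t, site g' t = (site g t).swap) ∧
        ∑ z ∈ trace g' s e, η z = ∑ z ∈ trace g s e, η z.swap := by
    intro g s e η hg
    have h0 : ∀ t, site (fun t => t - g t) t = (site g t).swap := fun t => by simp [site]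
    refine ⟨fun t => t - g t, fun t => ?_, h0, ?_⟩
    · have := hg t
      simp only []; omega
    · rw [sum_trace, sum_trace (ω := fun z => η z.swap)]
      simp [h0]
  constructor
  · rintro ⟨g, s, e, hg, hse, h1, h2, h3⟩
    obtain ⟨g', hg', h4, h5⟩ := key g s e (ω ∘ Equiv.prodComm ℤ ℤ) hg
    refine ⟨g', _, _, hg', hse, by rw [h4, h1]; simp, by rw [h4, h2]; simp, h5.trans ?_⟩
    simpa using h3
  · rintro ⟨g, s, e, hg, hse, h1, h2, h3⟩
    obtain ⟨g', hg', h4, h5⟩ := key g s e ω hg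
    exact ⟨g', _, _, hg', hse, by rw [h4, h1], by rw [h4, h2], h5.trans (by simpa using h3)⟩

theorem IsClimb.connect {g g' : ℤ → ℤ} (hg : IsClimb g) (hg' : IsClimb g') {s s' : ℤ}
    (hs : s < s') (h : site g s ≤ site g' s') :
    ∃ G, IsClimb G ∧ (∀ t ≤ s, G t = g t) ∧ ∀ t, s' ≤ t → G t = g' t := by
  obtain ⟨f, hf, f1, f2⟩ := exists_climb_of_le h
  rw [site_level] at f1 f2
  have f1' : f s = g s := congrArg Prod.fst f1
  have f2' : f s' = g' s' := congrArg Prod.fst f2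
  have h1 : IsClimb (fun t => if t ≤ s' then f t else g' t) :=
    hf.glue hg' (by rw [f2']; exact hg' s')
  refine ⟨_, hg.glue h1 (s := s) ?_, fun t ht => by simp [ht], fun t ht => ?_⟩
  · simp only [show s + 1 ≤ s' by omega, if_true]
    rw [← f1']; exact hf s
  · simp only [show ¬ t ≤ s by omega, if_false]
    split_ifs with h2
    · rw [show t = s' by omega, f2']
    · rfl

/-- Superadditivity of the passage times for non-negative weights. -/
theorem lastPassage_add_le {u v u' v' : ℤ × ℤ} {ω : Weights} (hω : ∀ z, 0 ≤ ω z)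
    (h : u ≤ v) (h' : u' ≤ v') (hv : v ≤ u') (hlev : v.1 + v.2 < u'.1 + u'.2) :
    lastPassage u v ω + lastPassage u' v' ω ≤ lastPassage u v' ω := by
  obtain ⟨g, hg, g1, g2, gw⟩ := exists_climb_lastPassage h ω
  obtain ⟨g', hg', g1', g2', gw'⟩ := exists_climb_lastPassage h' ω
  -- The gap between v and u' is filled by any upright path; its vertices only add non-negative
  -- weight.
  obtain ⟨G, hG, G1, G2⟩ := hg.connect hg' hlev (by rwa [g2, g1'])
  have a1 := Prod.le_def.1 h
  have a2 := Prod.le_def.1 h'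
  have e1 : site G (u.1 + u.2) = u := by rw [site, G1 _ (by omega)]; exact g1
  have e2 : site G (v'.1 + v'.2) = v' := by rw [site, G2 _ (by omega)]; exact g2'
  have key := hG.sum_le_lastPassage (s := u.1 + u.2) (e := v'.1 + v'.2) (by omega) ω
  rw [e1, e2] at key
  refine le_trans ?_ key
  have d : Disjoint (trace g (u.1 + u.2) (v.1 + v.2)) (trace g' (u'.1 + u'.2) (v'.1 + v'.2)) := by
    rw [Finset.disjoint_left]
    intro z h1 h2
    have := (mem_trace.1 h1).2.1
    have := (mem_trace.1 h2).1
    omega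
  rw [gw, gw', ← Finset.sum_union d]
  refine Finset.sum_le_sum_of_subset_of_nonneg (fun z hz => ?_) fun z _ _ => hω z
  rcases Finset.mem_union.1 hz with hz | hz <;> obtain ⟨h1, h2, h3⟩ := mem_trace.1 hz <;>
    refine mem_trace.2 ⟨by omega, by omega, ?_⟩
  · rw [G1 _ h2, ← h3]
  · rw [G2 _ h1, ← h3]

end Climb

/-! ### Exponential moments from tail bounds -/

section Moments

theorem exp_le_one_add_add_sq_mul_exp_abs (z : ℝ) :
    Real.exp z ≤ 1 + z + z ^ 2 * Real.exp |z| := by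
  have h := Complex.norm_exp_sub_sum_le_norm_mul_exp (z : ℂ) 2
  have h2 : Complex.exp z - ∑ m ∈ Finset.range 2, (z : ℂ) ^ m / (m.factorial : ℂ) =
      ((Real.exp z - (1 + z) : ℝ) : ℂ) := by
    simp [Finset.sum_range_succ]
  rw [h2, Complex.norm_real, Complex.norm_real, Real.norm_eq_abs, Real.norm_eq_abs, sq_abs] at h
  linarith [le_abs_self (Real.exp z - (1 + z))]

/-- If m < |y| ≤ m + 1, the m-th summand alone dominates; the 1 covers y = 0. -/
theorem exp_half_abs_le_tsum (c y : ℝ) (hc : 0 < c) :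
    ENNReal.ofReal (Real.exp (c / 2 * |y|)) ≤
      1 + ∑' n : ℕ, ENNReal.ofReal (Real.exp (c / 2 * (n + 1))) *
        Set.indicator {x : ℝ | (n : ℝ) < |x|} (fun _ => (1 : ℝ≥0∞)) y := by
  rcases Nat.eq_zero_or_eq_succ_pred ⌈|y|⌉₊ with h | h
  · have : |y| = 0 := le_antisymm (by simpa using Nat.ceil_eq_zero.1 h) (abs_nonneg y)
    simp [this]
  · set m := Nat.pred ⌈|y|⌉₊
    have h1 : |y| ≤ m + 1 := by
      have := Nat.le_ceil |y|
      rw [h] at this; exact_mod_cast this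
    have h2 : (m : ℝ) < |y| := Nat.lt_ceil.1 (by rw [h]; exact Nat.lt_succ_self m)
    refine le_trans ?_ ((ENNReal.le_tsum m).trans le_add_self)
    rw [Set.indicator_of_mem (show y ∈ {x : ℝ | (m : ℝ) < |x|} from h2), mul_one]
    refine ENNReal.ofReal_le_ofReal (Real.exp_le_exp.2 ?_)
    exact mul_le_mul_of_nonneg_left h1 (by positivity)

/-- Exponential moments of a variable with exponential tails, with constants depending only on
the tails. -/
theorem exists_exp_abs_moment_bound {c : ℝ} (hc : 0 < c) (θ₁ : ℝ) :
    ∃ K : ℝ, 0 < K ∧ ∀ {Ω : Type} [MeasurableSpace Ω] (P : Measure Ω) [IsProbabilityMeasure P]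
      (Y : Ω → ℝ), Measurable Y →
      (∀ θ > θ₁, P.real {ω | Y ω > θ} ≤ Real.exp (-c * θ)) →
      (∀ θ > θ₁, P.real {ω | Y ω < -θ} ≤ Real.exp (-c * θ)) →
      ∫⁻ ω, ENNReal.ofReal (Real.exp (c / 2 * |Y ω|)) ∂P ≤ ENNReal.ofReal K := by
  -- The 2 counts the two tails beyond θ₁; the exponential makes the tail bound at least 1, hence
  -- trivial, up to θ₁.
  set K' : ℝ := 2 + Real.exp (c * θ₁) with hK'
  have hK'0 : 0 < K' := by positivity
  set ρ : ℝ := Real.exp (-(c / 2)) with hρ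
  have hρ0 : 0 ≤ ρ := (Real.exp_pos _).le
  have hρ1 : ρ < 1 := by rw [hρ]; simpa using hc
  set a : ℝ := K' * Real.exp (c / 2) with ha
  have ha0 : 0 ≤ a := by positivity
  have hsum : Summable fun n : ℕ => a * ρ ^ n := (summable_geometric_of_lt_one hρ0 hρ1).mul_left _
  have hnn : ∀ n : ℕ, 0 ≤ a * ρ ^ n := fun n => by positivity
  refine ⟨1 + ∑' n : ℕ, a * ρ ^ n, add_pos_of_pos_of_nonneg one_pos (tsum_nonneg hnn), ?_⟩
  intro Ω _ P _ Y hY h1 h2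
  have htail : ∀ n : ℕ, P.real {ω | (n : ℝ) < |Y ω|} ≤ K' * Real.exp (-c * n) := by
    intro n
    rcases le_or_gt (n : ℝ) θ₁ with h | h
    · refine measureReal_le_one.trans ?_
      have : Real.exp (c * θ₁) * Real.exp (-c * n) ≤ K' * Real.exp (-c * n) := by
        gcongr; linarith
      refine le_trans ?_ this
      rw [← Real.exp_add]
      exact Real.one_le_exp (by nlinarith)
    · have hsub : {ω | (n : ℝ) < |Y ω|} ⊆ {ω | Y ω > n} ∪ {ω | Y ω < -n} := by
        intro ω (hω : (n : ℝ) < |Y ω|)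
        rcases lt_abs.1 hω with h | h
        · exact Or.inl h
        · exact Or.inr (show Y ω < -n by linarith)
      calc _ ≤ P.real ({ω | Y ω > n} ∪ {ω | Y ω < -n}) := measureReal_mono hsub
        _ ≤ _ := measureReal_union_le _ _
        _ ≤ Real.exp (-c * n) + Real.exp (-c * n) := add_le_add (h1 n h) (h2 n h)
        _ ≤ _ := by
          have := mul_pos (Real.exp_pos (c * θ₁)) (Real.exp_pos (-c * n))
          rw [hK']; linarith
  have hms : ∀ n : ℕ, MeasurableSet {x : ℝ | (n : ℝ) < |x|} := fun n =>
    (isOpen_lt continuous_const continuous_abs).measurableSet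
  calc ∫⁻ ω, ENNReal.ofReal (Real.exp (c / 2 * |Y ω|)) ∂P
      ≤ ∫⁻ ω, (1 + ∑' n : ℕ, ENNReal.ofReal (Real.exp (c / 2 * (n + 1))) *
        Set.indicator {x : ℝ | (n : ℝ) < |x|} (fun _ => (1 : ℝ≥0∞)) (Y ω)) ∂P :=
        lintegral_mono fun ω => exp_half_abs_le_tsum c (Y ω) hc
    _ = 1 + ∑' n : ℕ, ENNReal.ofReal (Real.exp (c / 2 * (n + 1))) *
        P {ω | (n : ℝ) < |Y ω|} := by
        rw [lintegral_add_left measurable_const, lintegral_tsum]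
        · congr 1
          · simp
          · refine tsum_congr fun n => ?_
            rw [lintegral_const_mul' _ _ ENNReal.ofReal_ne_top]
            congr 1
            rw [show (fun ω => Set.indicator {x : ℝ | (n : ℝ) < |x|} (fun _ => (1 : ℝ≥0∞)) (Y ω)) =
              Set.indicator {ω | (n : ℝ) < |Y ω|} (fun _ => (1 : ℝ≥0∞)) from by
                ext ω; simp [Set.indicator]]
            exact (lintegral_indicator_const (hY (hms n)) 1).trans (one_mul _)
        · exact fun n => (((measurable_const.indicator (hms n)).comp hY).const_mul _).aemeasurable
    _ ≤ 1 + ∑' n : ℕ, ENNReal.ofReal (a * ρ ^ n) := by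
        gcongr with n
        rw [← ofReal_measureReal, ← ENNReal.ofReal_mul (Real.exp_pos _).le]
        refine ENNReal.ofReal_le_ofReal ?_
        refine (mul_le_mul_of_nonneg_left (htail n) (Real.exp_pos _).le).trans (le_of_eq ?_)
        rw [ha, hρ, ← Real.exp_nat_mul, mul_left_comm, ← Real.exp_add, mul_assoc, ← Real.exp_add]
        congr 2; ring
    _ = _ := by
        rw [← ENNReal.ofReal_tsum_of_nonneg hnn hsum,
          ENNReal.ofReal_add zero_le_one (tsum_nonneg hnn), ENNReal.ofReal_one]

/-- Second-order expansion: the linear term integrates to zero, and for s ≤ c/4 the remainder is at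
most a multiple of s² exp(c|Y|/2), whose mean is bounded by the tails alone. -/
theorem exists_centered_mgf_bound {c : ℝ} (hc : 0 < c) (θ₁ : ℝ) :
    ∃ C s₀ : ℝ, 0 < C ∧ 0 < s₀ ∧
      ∀ {Ω : Type} [MeasurableSpace Ω] (P : Measure Ω) [IsProbabilityMeasure P]
      (Y : Ω → ℝ), Measurable Y → Integrable Y P → ∫ ω, Y ω ∂P = 0 →
      (∀ θ > θ₁, P.real {ω | Y ω > θ} ≤ Real.exp (-c * θ)) →
      (∀ θ > θ₁, P.real {ω | Y ω < -θ} ≤ Real.exp (-c * θ)) →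
      ∀ s, 0 ≤ s → s ≤ s₀ →
        ∫⁻ ω, ENNReal.ofReal (Real.exp (s * Y ω)) ∂P ≤ ENNReal.ofReal (Real.exp (C * s ^ 2)) := by
  obtain ⟨K, hK, hbound⟩ := exists_exp_abs_moment_bound hc θ₁
  refine ⟨32 / c ^ 2 * K, c / 4, by positivity, by positivity, ?_⟩
  intro Ω _ P _ Y hY hYi hY0 h1 h2 s hs0 hs
  have hM := hbound P Y hY h1 h2
  have hEm : Measurable fun ω => Real.exp (c / 2 * |Y ω|) := by fun_prop
  have hEi : Integrable (fun ω => Real.exp (c / 2 * |Y ω|)) P := by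
    refine ⟨hEm.aestronglyMeasurable, ?_⟩
    rw [hasFiniteIntegral_iff_ofReal (ae_of_all _ fun ω => (Real.exp_pos _).le)]
    exact hM.trans_lt ENNReal.ofReal_lt_top
  have hE : ∫ ω, Real.exp (c / 2 * |Y ω|) ∂P ≤ K := by
    rw [integral_eq_lintegral_of_nonneg_ae (ae_of_all _ fun ω => (Real.exp_pos _).le)
      hEm.aestronglyMeasurable]
    exact ENNReal.toReal_le_of_le_ofReal hK.le hM
  have hpt : ∀ y : ℝ, Real.exp (s * y) ≤
      1 + s * y + 32 / c ^ 2 * s ^ 2 * Real.exp (c / 2 * |y|) := by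
    intro y
    have a1 := exp_le_one_add_add_sq_mul_exp_abs (s * y)
    have a2 : Real.exp |s * y| ≤ Real.exp (c / 4 * |y|) := by
      rw [abs_mul, abs_of_nonneg hs0]
      exact Real.exp_le_exp.2 (mul_le_mul_of_nonneg_right hs (abs_nonneg y))
    -- This is z²/2 ≤ e^z at z = c|y|/4, the source of the constant 32/c².
    have a3 : (c / 4 * |y|) ^ 2 / 2 ≤ Real.exp (c / 4 * |y|) := by
      have := Real.quadratic_le_exp_of_nonneg (show 0 ≤ c / 4 * |y| by positivity)
      nlinarith [show 0 ≤ c / 4 * |y| by positivity]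
    have a4 : y ^ 2 ≤ 32 / c ^ 2 * Real.exp (c / 4 * |y|) := by
      rw [mul_pow, sq_abs] at a3
      rw [div_mul_eq_mul_div, le_div_iff₀ (by positivity)]
      nlinarith
    have a5 : Real.exp (c / 2 * |y|) = Real.exp (c / 4 * |y|) * Real.exp (c / 4 * |y|) := by
      rw [← Real.exp_add]; congr 1; ring
    have a6 : (s * y) ^ 2 * Real.exp |s * y| ≤
        32 / c ^ 2 * s ^ 2 * Real.exp (c / 2 * |y|) := by
      rw [a5]
      calc (s * y) ^ 2 * Real.exp |s * y| = s ^ 2 * (y ^ 2 * Real.exp |s * y|) := by ring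
        _ ≤ s ^ 2 * (32 / c ^ 2 * Real.exp (c / 4 * |y|) * Real.exp (c / 4 * |y|)) := by
          gcongr
        _ = _ := by ring
    linarith
  have hRi : Integrable (fun ω => 1 + s * Y ω + 32 / c ^ 2 * s ^ 2 * Real.exp (c / 2 * |Y ω|)) P :=
    ((integrable_const _).add (hYi.const_mul s)).add (hEi.const_mul _)
  calc _ ≤ ∫⁻ ω, ENNReal.ofReal
        (1 + s * Y ω + 32 / c ^ 2 * s ^ 2 * Real.exp (c / 2 * |Y ω|)) ∂P :=
        lintegral_mono fun ω => ENNReal.ofReal_le_ofReal (hpt _)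
    _ = ENNReal.ofReal (∫ ω,
        (1 + s * Y ω + 32 / c ^ 2 * s ^ 2 * Real.exp (c / 2 * |Y ω|)) ∂P) :=
        (ofReal_integral_eq_lintegral_ofReal hRi
          (ae_of_all _ fun ω => (Real.exp_pos _).le.trans (hpt _))).symm
    _ ≤ _ := by
        refine ENNReal.ofReal_le_ofReal ?_
        have hi : Integrable (fun ω => 1 + s * Y ω) P :=
          (integrable_const _).add (hYi.const_mul s)
        rw [integral_add hi (hEi.const_mul _),
          integral_add (integrable_const _) (hYi.const_mul s), integral_const_mul,
          integral_const_mul, hY0]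
        simp only [integral_const, probReal_univ, smul_eq_mul, mul_one, mul_zero, add_zero]
        have : 32 / c ^ 2 * s ^ 2 * ∫ ω, Real.exp (c / 2 * |Y ω|) ∂P ≤ 32 / c ^ 2 * s ^ 2 * K := by
          gcongr
        nlinarith [Real.add_one_le_exp (32 / c ^ 2 * K * s ^ 2)]

/-- Jensen's inequality for the exponential function. -/
theorem ofReal_exp_integral_le {Ω : Type*} [MeasurableSpace Ω] (P : Measure Ω)
    [IsProbabilityMeasure P] {Y : Ω → ℝ} (hY : Integrable Y P) :
    ENNReal.ofReal (Real.exp (∫ ω, Y ω ∂P)) ≤ ∫⁻ ω, ENNReal.ofReal (Real.exp (Y ω)) ∂P := by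
  set m := ∫ ω, Y ω ∂P with hm
  -- The tangent line at the mean; the argument never needs exp(Y) to be integrable.
  have hpt : ∀ y, Real.exp m * (1 + (y - m)) ≤ Real.exp y := by
    intro y
    have := Real.add_one_le_exp (y - m)
    calc _ ≤ Real.exp m * Real.exp (y - m) := by gcongr; linarith
      _ = _ := by rw [← Real.exp_add]; congr 1; ring
  have hi : Integrable (fun ω => Real.exp m * (1 + (Y ω - m))) P :=
    ((integrable_const _).add (hY.sub (integrable_const _))).const_mul _
  calc ENNReal.ofReal (Real.exp m)
      = ENNReal.ofReal (∫ ω, Real.exp m * (1 + (Y ω - m)) ∂P) := by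
        have hi' : Integrable (fun ω => Y ω - m) P := hY.sub (integrable_const _)
        rw [integral_const_mul, integral_add (integrable_const _) hi',
          integral_sub hY (integrable_const _)]
        simp [← hm]
    _ ≤ ∫⁻ ω, ENNReal.ofReal (Real.exp m * (1 + (Y ω - m))) ∂P := by
        rw [integral_eq_lintegral_pos_part_sub_lintegral_neg_part hi]
        refine (ENNReal.ofReal_le_ofReal (sub_le_self _ ENNReal.toReal_nonneg)).trans ?_
        exact ENNReal.ofReal_toReal_le
    _ ≤ _ := lintegral_mono fun ω => ENNReal.ofReal_le_ofReal (hpt _)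

end Moments

/-! ### Exponential moments in the diagonal direction -/

section Diagonal

variable {ν : Measure ℝ} [IsProbabilityMeasure ν]

theorem ae_nonneg_weights (hν : ν (Set.Iio 0) = 0) : ∀ᵐ ω ∂fieldLaw ν, ∀ z, 0 ≤ ω z := by
  rw [ae_all_iff]
  intro z
  have hmp : MeasurePreserving (Function.eval z) (fieldLaw ν) ν :=
    measurePreserving_eval_infinitePi (fun _ => ν) z
  have : ∀ᵐ x ∂ν, 0 ≤ x := by
    rw [ae_iff]; simpa [Set.Iio] using hν
  exact hmp.quasiMeasurePreserving.ae this

theorem passageTo_natCast (r : ℕ) : passageTo r r = lastPassage (1, 1) (r, r) := by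
  funext ω; simp [passageTo]

/-- The passage time is centred at its mean and divided by R^{1/3}; the non-random deficit of the
mean supplies the term −gR^{1/3}. -/
theorem exists_diagonal_mgf_bound {μ : ℝ} (hμ : HasGrowthRate ν μ)
    (hshape : LimitShapeAssumption ν μ) (htail : TailAssumption ν) :
    ∃ g C s₀ : ℝ, 0 < g ∧ 0 < C ∧ 0 < s₀ ∧ ∃ R₀ : ℕ, ∀ R : ℕ, R₀ ≤ R → ∀ lam : ℝ, 0 ≤ lam →
      lam * (R : ℝ) ^ (1 / 3 : ℝ) ≤ s₀ →
      ∫⁻ ω, ENNReal.ofReal (Real.exp (lam * lastPassage (1, 1) (R, R) ω)) ∂fieldLaw ν ≤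
        ENNReal.ofReal (Real.exp (lam * (μ * R - g * (R : ℝ) ^ (1 / 3 : ℝ)) +
          C * (lam * (R : ℝ) ^ (1 / 3 : ℝ)) ^ 2)) := by
  obtain ⟨ρ, G₁, G₂, g₁, g₂, hρ, -, -, -, -, hg₂, r₁, hr₁⟩ := hshape
  obtain ⟨c, θ₀, r₀, hc, hθ₀, hr₀, ht⟩ := htail 1 one_pos
  -- Beyond 1 one has θ ≤ θ^{3/2}, so both tails are at most exp(−cθ).
  obtain ⟨C, s₀, hC, hs₀, hmgf⟩ := exists_centered_mgf_bound hc (max θ₀ 1)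
  refine ⟨g₂, C, s₀, hg₂, hC, hs₀, max (max r₁ 1) (⌊r₀⌋₊ + 1), fun R hR lam hlam hlamR => ?_⟩
  have hR1 : 1 ≤ R := by omega
  have hRr : r₀ < R := (Nat.lt_floor_add_one r₀).trans_le (by exact_mod_cast (by omega))
  have hR1' : (1 : ℝ) ≤ R := by exact_mod_cast hR1
  set σ : ℝ := (R : ℝ) ^ (1 / 3 : ℝ) with hσ
  have hσ1 : 1 ≤ σ := Real.one_le_rpow hR1' (by norm_num)
  have hσ0 : 0 < σ := by linarith
  set X := lastPassage (1, 1) ((R : ℤ), (R : ℤ)) with hX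
  set m := meanPassage ν R R with hm
  have hXi : Integrable X (fieldLaw ν) := by
    have := hμ.1 R hR1
    rwa [passageTo_natCast] at this
  have hmX : m = ∫ ω, X ω ∂fieldLaw ν := by
    rw [hm, meanPassage, passageTo_natCast]
  have hmean : m ≤ μ * R - g₂ * σ := by
    have := (hr₁ R (by omega) 0 ⟨by linarith, hρ.le⟩).2
    simp only [sub_zero, add_zero, mul_one] at this
    rw [← hm] at this
    simp at this; linarith
  set Y : Weights → ℝ := fun ω => (X ω - m) / σ with hY
  have hYX : ∀ ω, lam * X ω = lam * m + lam * σ * Y ω := fun ω => by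
    simp only [hY]; field_simp; ring
  have htR := ht 0 (by simp) R hRr
  simp only [add_zero, sub_zero, mul_one, passageTo_natCast, ← hm, ← hσ, ← hX] at htR
  have hmgfY := hmgf (fieldLaw ν) Y
    (((measurable_lastPassage _ _).sub measurable_const).div_const _)
    ((hXi.sub (integrable_const _)).div_const _) ?_ ?_ ?_ (lam * σ) (by positivity) hlamR
  · calc ∫⁻ ω, ENNReal.ofReal (Real.exp (lam * X ω)) ∂fieldLaw ν
        = ENNReal.ofReal (Real.exp (lam * m)) *
          ∫⁻ ω, ENNReal.ofReal (Real.exp (lam * σ * Y ω)) ∂fieldLaw ν := by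
          rw [← lintegral_const_mul']
          · refine lintegral_congr fun ω => ?_
            rw [hYX, Real.exp_add, ENNReal.ofReal_mul (Real.exp_pos _).le]
          · exact ENNReal.ofReal_ne_top
      _ ≤ ENNReal.ofReal (Real.exp (lam * m)) *
          ENNReal.ofReal (Real.exp (C * (lam * σ) ^ 2)) := by gcongr
      _ = ENNReal.ofReal (Real.exp (lam * m + C * (lam * σ) ^ 2)) := by
          rw [Real.exp_add, ENNReal.ofReal_mul (Real.exp_pos _).le]
      _ ≤ _ := by gcongr
  · simp only [hY]
    rw [integral_div, integral_sub hXi (integrable_const _), ← hmX]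
    simp
  · intro θ hθ
    have hθ1 : 1 < θ := (le_max_right _ _).trans_lt hθ
    have e : {ω | Y ω > θ} = {ω | X ω - m > θ * σ} := by
      ext ω; simp [hY, lt_div_iff₀ hσ0]
    rw [e]
    refine (htR θ ((le_max_left _ _).trans_lt hθ)).1.trans (Real.exp_le_exp.2 ?_)
    have h1 : θ ≤ θ ^ (3 / 2 : ℝ) := by
      simpa using Real.rpow_le_rpow_of_exponent_le hθ1.le (show (1 : ℝ) ≤ 3 / 2 by norm_num)
    have h2 : θ ≤ min (θ ^ (3 / 2 : ℝ)) (θ * σ) := le_min h1 (by nlinarith)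
    nlinarith
  · intro θ hθ
    have hθ1 : 1 < θ := (le_max_right _ _).trans_lt hθ
    have e : {ω | Y ω < -θ} = {ω | X ω - m < -θ * σ} := by
      ext ω; simp [hY, div_lt_iff₀ hσ0]
    rw [e]
    refine (htR θ ((le_max_left _ _).trans_lt hθ)).2.trans (Real.exp_le_exp.2 ?_)
    have h1 : θ ≤ θ ^ (3 / 2 : ℝ) := by
      simpa using Real.rpow_le_rpow_of_exponent_le hθ1.le (show (1 : ℝ) ≤ 3 / 2 by norm_num)
    nlinarith

end Diagonal

/-! ### Translation, reflection and off-diagonal passage times -/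

section Invariance

variable {ν : Measure ℝ} [IsProbabilityMeasure ν]

theorem measurable_exp_lastPassage (lam : ℝ) (u v : ℤ × ℤ) :
    Measurable fun ω => ENNReal.ofReal (Real.exp (lam * lastPassage u v ω)) :=
  ENNReal.measurable_ofReal.comp
    (Real.measurable_exp.comp ((measurable_lastPassage u v).const_mul lam))

/-- The exponential moment of a last passage value. -/
def passageMGF (ν : Measure ℝ) (lam : ℝ) (u v : ℤ × ℤ) : ℝ≥0∞ :=
  ∫⁻ ω, ENNReal.ofReal (Real.exp (lam * lastPassage u v ω)) ∂fieldLaw ν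

theorem passageMGF_translate (lam : ℝ) (u v a : ℤ × ℤ) :
    passageMGF ν lam (u + a) (v + a) = passageMGF ν lam u v := by
  simp only [passageMGF, lastPassage_translate]
  exact (measurePreserving_comp_equiv ν (Equiv.addRight a)).lintegral_comp
    (measurable_exp_lastPassage lam u v)

theorem passageMGF_swap (lam : ℝ) (u v : ℤ × ℤ) :
    passageMGF ν lam u.swap v.swap = passageMGF ν lam u v := by
  simp only [passageMGF, lastPassage_swap]
  exact (measurePreserving_comp_equiv ν (Equiv.prodComm ℤ ℤ)).lintegral_comp
    (measurable_exp_lastPassage lam u v)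

theorem integral_lastPassage_translate (u v a : ℤ × ℤ) :
    ∫ ω, lastPassage (u + a) (v + a) ω ∂fieldLaw ν = ∫ ω, lastPassage u v ω ∂fieldLaw ν := by
  simp only [lastPassage_translate]
  have h := measurePreserving_comp_equiv ν (Equiv.addRight a)
  rw [← integral_map h.measurable.aemeasurable (f := lastPassage u v)
    (measurable_lastPassage u v).aestronglyMeasurable, h.map_eq]

theorem integrable_lastPassage_translate {u v : ℤ × ℤ} (a : ℤ × ℤ)
    (h : Integrable (lastPassage u v) (fieldLaw ν)) :
    Integrable (lastPassage (u + a) (v + a)) (fieldLaw ν) := by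
  have : lastPassage (u + a) (v + a) = lastPassage u v ∘ fun ω => ω ∘ Equiv.addRight a :=
    funext fun ω => lastPassage_translate u v a ω
  rw [this]
  exact (measurePreserving_comp_equiv ν (Equiv.addRight a)).integrable_comp_of_integrable h

theorem lastPassage_le_of_le {u v w : ℤ × ℤ} {ω : Weights} (hω : ∀ z, 0 ≤ ω z) (huv : u ≤ v)
    (hvw : v ≤ w) : lastPassage u v ω ≤ lastPassage u w ω := by
  rcases eq_or_ne v w with rfl | hne
  · exact le_rfl
  · have h1 := Prod.le_def.1 hvw
    have h2 : v.1 + v.2 < w.1 + w.2 := by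
      by_contra h
      exact hne (Prod.ext (by omega) (by omega))
    have := lastPassage_add_le hω huv (le_refl w) hvw h2
    linarith [lastPassage_nonneg w w hω]

/-- Off-diagonal exponential moments are controlled by those in the diagonal direction: follow the
path by a copy of its reflection. -/
theorem passageMGF_sq_le (hν : ν (Set.Iio 0) = 0) {lam : ℝ} (hlam : 0 ≤ lam) {u v : ℤ × ℤ}
    (huv : u ≤ v) {R : ℕ} (hR : v.1 + v.2 - (u.1 + u.2) + 2 = 2 * R) :
    passageMGF ν lam u v ^ 2 ≤
      passageMGF ν lam (1, 1) (((2 * R : ℕ) : ℤ), ((2 * R : ℕ) : ℤ)) := by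
  obtain ⟨a, ha⟩ : ∃ a : ℤ, a = v.1 - u.1 + 1 := ⟨_, rfl⟩
  obtain ⟨b, hb⟩ : ∃ b : ℤ, b = v.2 - u.2 + 1 := ⟨_, rfl⟩
  have h0 := Prod.le_def.1 huv
  have hab : a + b = 2 * R := by omega
  have e1 : passageMGF ν lam u v = passageMGF ν lam (1, 1) (a, b) := by
    rw [← passageMGF_translate lam (1, 1) (a, b) (u - (1, 1))]
    congr 1
    · simp
    · ext <;> simp [ha, hb]
  -- The second rectangle has sides b and a: it is a reflected translate of the first. It starts on
  -- level a + b + 1, just above the end of the first, and a + b = 2R, so the two together fit below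
  -- the diagonal point (2R, 2R).
  have e2 : passageMGF ν lam (a + 1, b) (a + b, a + b - 1) = passageMGF ν lam (1, 1) (a, b) := by
    rw [← passageMGF_swap lam (a + 1, b), ← passageMGF_translate lam (1, 1) (a, b) (b - 1, a)]
    congr 1 <;> ext <;> simp <;> ring
  set S : Set (ℤ × ℤ) := {z | z.1 + z.2 ≤ a + b}
  have key := lintegral_diag_eq ν S (f := fun ω ω' =>
    ENNReal.ofReal (Real.exp (lam * lastPassage (1, 1) (a, b) ω)) *
      ENNReal.ofReal (Real.exp (lam * lastPassage (a + 1, b) (a + b, a + b - 1) ω')))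
    (((measurable_exp_lastPassage lam _ _).comp measurable_fst).mul
      ((measurable_exp_lastPassage lam _ _).comp measurable_snd)) (by
      intro ω₁ ω₂ η₁ η₂ h1 h2
      have c1 : lastPassage (1, 1) (a, b) ω₁ = lastPassage (1, 1) (a, b) η₁ :=
        lastPassage_congr fun z _ hz => h1 z hz
      have c2 : lastPassage (a + 1, b) (a + b, a + b - 1) ω₂ =
          lastPassage (a + 1, b) (a + b, a + b - 1) η₂ :=
        lastPassage_congr fun z hz _ => h2 z (by
          simp only [S, Set.mem_ofPred_eq]; simp only at hz; omega)
      simp only [c1, c2])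
  have hprod : passageMGF ν lam u v ^ 2 = passageMGF ν lam (1, 1) (a, b) *
      passageMGF ν lam (a + 1, b) (a + b, a + b - 1) := by rw [e1, e2, sq]
  rw [hprod, passageMGF, passageMGF, ← lintegral_mul_const _ (measurable_exp_lastPassage lam _ _)]
  simp_rw [← lintegral_const_mul _ (measurable_exp_lastPassage lam (a + 1, b) (a + b, a + b - 1))]
  rw [← key]
  refine lintegral_mono_ae ?_
  filter_upwards [ae_nonneg_weights hν] with ω hω
  rw [← ENNReal.ofReal_mul (Real.exp_pos _).le, ← Real.exp_add, ← mul_add]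
  refine ENNReal.ofReal_le_ofReal (Real.exp_le_exp.2 (mul_le_mul_of_nonneg_left ?_ hlam))
  refine (lastPassage_add_le hω ?_ ?_ ?_ ?_).trans (lastPassage_le_of_le hω ?_ ?_)
  all_goals first
    | (simp only [Prod.mk_le_mk]; push_cast; constructor <;> omega)
    | (simp only; omega)

/-- After translation to (1,1), monotonicity dominates the passage time by a diagonal one. -/
theorem integrable_lastPassage (hν : ν (Set.Iio 0) = 0) {μ : ℝ} (hμ : HasGrowthRate ν μ)
    {u v : ℤ × ℤ} (huv : u ≤ v) : Integrable (lastPassage u v) (fieldLaw ν) := by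
  obtain ⟨a, ha⟩ : ∃ a : ℤ, a = v.1 - u.1 + 1 := ⟨_, rfl⟩
  obtain ⟨b, hb⟩ : ∃ b : ℤ, b = v.2 - u.2 + 1 := ⟨_, rfl⟩
  have h0 := Prod.le_def.1 huv
  have h1 : Integrable (lastPassage (1, 1) (a, b)) (fieldLaw ν) := by
    obtain ⟨R, hR⟩ : ∃ R : ℕ, (R : ℤ) = a + b := ⟨(a + b).toNat, by omega⟩
    have hi := hμ.1 R (by omega)
    rw [passageTo_natCast] at hi
    refine hi.mono' (measurable_lastPassage _ _).aestronglyMeasurable ?_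
    filter_upwards [ae_nonneg_weights hν] with ω hω
    rw [Real.norm_of_nonneg (lastPassage_nonneg _ _ hω)]
    refine lastPassage_le_of_le hω ?_ ?_ <;> simp only [Prod.mk_le_mk] <;> constructor <;> omega
  have := integrable_lastPassage_translate (u - (1, 1)) h1
  convert this using 2
  · simp
  · ext <;> simp [ha, hb]

/-- The lower half of the limit shape hypothesis, put in terms of arbitrary lattice endpoints: a
horizontal deviation of at most h costs at most G₁h²/r. -/
theorem exists_integral_lastPassage_ge {μ : ℝ} (hshape : LimitShapeAssumption ν μ) :
    ∃ ρ G₁ g₁ : ℝ, 0 < ρ ∧ ρ < 1 ∧ 0 < G₁ ∧ 0 < g₁ ∧ ∃ r₀ : ℕ, ∀ r : ℕ, r₀ ≤ r → 1 ≤ r →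
      ∀ u v : ℤ × ℤ, v.1 + v.2 - (u.1 + u.2) + 2 = 2 * r → ∀ h : ℝ,
        |(v.1 : ℝ) - u.1 + 1 - r| ≤ h → h ≤ ρ * r →
        μ * r - G₁ * h ^ 2 / r - g₁ * (r : ℝ) ^ (1 / 3 : ℝ) ≤
          ∫ ω, lastPassage u v ω ∂fieldLaw ν := by
  obtain ⟨ρ, G₁, G₂, g₁, g₂, hρ, hρ1, hG₁, -, hg₁, -, r₀, hr₀⟩ := hshape
  refine ⟨ρ, G₁, g₁, hρ, hρ1, hG₁, hg₁, r₀, fun r hr hr1 u v huv h hh hhr => ?_⟩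
  have hrpos : (0 : ℝ) < r := by exact_mod_cast hr1
  obtain ⟨a, ha⟩ : ∃ a : ℤ, a = v.1 - u.1 + 1 := ⟨_, rfl⟩
  obtain ⟨b, hb⟩ : ∃ b : ℤ, b = v.2 - u.2 + 1 := ⟨_, rfl⟩
  have hab : (a : ℝ) + b = 2 * r := by exact_mod_cast (by omega : a + b = 2 * (r : ℤ))
  have haR : (a : ℝ) = v.1 - u.1 + 1 := by rw [ha]; push_cast; ring
  rw [← haR] at hh
  set x : ℝ := (r - a) / r with hx
  have hxr : x * r = r - a := by rw [hx]; field_simp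
  have e1 : (r : ℝ) * (1 - x) = (a : ℤ) := by linarith
  have e2 : (r : ℝ) * (1 + x) = (b : ℤ) := by linarith
  have habs : |x| * r ≤ h := by
    have : |x * r| = |x| * r := by rw [abs_mul, abs_of_pos hrpos]
    rw [← this, hxr, abs_sub_comm]; exact hh
  have hxρ : |x| ≤ ρ := le_of_mul_le_mul_right (habs.trans hhr) hrpos
  have key := (hr₀ r hr x (abs_le.1 hxρ)).1
  have em : meanPassage ν (r * (1 - x)) (r * (1 + x)) = ∫ ω, lastPassage u v ω ∂fieldLaw ν := by
    rw [meanPassage, e1, e2]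
    simp only [passageTo, Int.floor_intCast]
    rw [← integral_lastPassage_translate (1, 1) (a, b) (u - (1, 1))]
    congr 2
    funext ω
    congr 1
    · simp
    · ext <;> simp [ha, hb]
  rw [em] at key
  have hsq : x ^ 2 * r ≤ h ^ 2 / r := by
    rw [le_div_iff₀ hrpos]
    calc x ^ 2 * r * r = (|x| * r) ^ 2 := by rw [mul_pow, sq_abs]; ring
      _ ≤ h ^ 2 := pow_le_pow_left₀ (by positivity) habs 2
  have : G₁ * (x ^ 2 * r) ≤ G₁ * (h ^ 2 / r) := mul_le_mul_of_nonneg_left hsq hG₁.le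
  rw [mul_div_assoc]
  linarith

end Invariance

/-! ### From crossings to point-to-point passage times -/

section Crossing

variable {ν : Measure ℝ} [IsProbabilityMeasure ν]

/-- The sets of vertices contained in a crossing from an interval of length `h` on level `t₀` to an
interval of length `h` on level `t₁`. -/
def crossings (t₀ t₁ α β h : ℤ) : Set (Finset (ℤ × ℤ)) :=
  {B | ∃ g, IsClimb g ∧ α ≤ g t₀ ∧ g t₀ < α + h ∧ β ≤ g t₁ ∧ g t₁ < β + h ∧ B ⊆ trace g t₀ t₁}

theorem crossings_bounded (t₀ t₁ α β h : ℤ) :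
    ∃ T : Finset (ℤ × ℤ), ∀ B ∈ crossings t₀ t₁ α β h, B ⊆ T := by
  refine ⟨Finset.Icc (α, t₀ - (α + h)) (α + h + (t₁ - t₀), t₁ - α), ?_⟩
  rintro B ⟨g, hg, h1, h2, h3, h4, hB⟩ z hz
  obtain ⟨a1, a2, a3⟩ := mem_trace.1 (hB hz)
  have := hg.le_of_le a1
  simp only [Finset.mem_Icc, Prod.le_def]
  omega

/-- Extending crossings backwards and forwards to fixed points compares their exponential moments
with those of a point-to-point passage time. -/
theorem lintegral_expSup_crossings_mul_le (hν : ν (Set.Iio 0) = 0) {lam : ℝ} (hlam : 0 ≤ lam)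
    {t₀ t₁ α β h τ : ℤ} (ht : t₀ ≤ t₁) (hτ : h ≤ τ) {M : ℝ}
    (hM : ∀ u v : ℤ × ℤ, u ≤ v → v.1 + v.2 - (u.1 + u.2) + 2 = 2 * τ →
      |v.1 - u.1 + 1 - τ| ≤ h → Integrable (lastPassage u v) (fieldLaw ν) ∧
        M ≤ ∫ ω, lastPassage u v ω ∂fieldLaw ν) :
    (∫⁻ ω, expSup lam (crossings t₀ t₁ α β h) ω ∂fieldLaw ν) *
        ENNReal.ofReal (Real.exp (lam * (2 * M))) ≤
      passageMGF ν lam (α - τ, t₀ + 1 - τ - α) (β + τ, t₁ + τ - β) := by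
  set u₀ : ℤ × ℤ := (α - τ, t₀ + 1 - τ - α) with hu₀
  set v₀ : ℤ × ℤ := (β + τ, t₁ + τ - β) with hv₀
  -- A set B need not reach the end levels, so the end positions are recorded with it; they fix
  -- where the legs attach.
  set T : Set (Finset (ℤ × ℤ) × ℤ × ℤ) := {x | ∃ g, IsClimb g ∧ α ≤ g t₀ ∧ g t₀ < α + h ∧
    β ≤ g t₁ ∧ g t₁ < β + h ∧ x.1 ⊆ trace g t₀ t₁ ∧ x.2.1 = g t₀ ∧ x.2.2 = g t₁} with hT
  set p : Finset (ℤ × ℤ) × ℤ × ℤ → ℤ × ℤ := fun x => (x.2.1 - 1, t₀ - x.2.1) with hp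
  -- Level t₁ + 1 is skipped for parity: both legs then run between points whose level difference is
  -- 2τ − 2.
  set q : Finset (ℤ × ℤ) × ℤ × ℤ → ℤ × ℤ := fun x => (x.2.2 + 1, t₁ - x.2.2 + 1) with hq
  set H : Finset (ℤ × ℤ) × ℤ × ℤ → Weights → ℝ := fun x ω =>
    lam * (lastPassage u₀ (p x) ω + lastPassage (q x) v₀ ω) with hH
  have hHm : ∀ x, Measurable fun ω => ENNReal.ofReal (Real.exp (H x ω)) := fun x =>
    ENNReal.measurable_ofReal.comp (Real.measurable_exp.comp
      (((measurable_lastPassage _ _).add (measurable_lastPassage _ _)).const_mul lam))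
  set f : Weights → Weights → ℝ≥0∞ := fun ω ω' => ⨆ x ∈ T,
    (∏ z ∈ x.1, ENNReal.ofReal (Real.exp (lam * ω z))) * ENNReal.ofReal (Real.exp (H x ω')) with hf
  have hfm : Measurable (Function.uncurry f) :=
    Measurable.biSup _ T.to_countable fun x _ =>
      ((measurable_expWeight lam x.1).comp measurable_fst).mul ((hHm x).comp measurable_snd)
  have key := lintegral_diag_eq ν {z | t₀ ≤ z.1 + z.2 ∧ z.1 + z.2 ≤ t₁} hfm (by
    intro ω₁ ω₂ η₁ η₂ h1 h2
    refine iSup_congr fun x => iSup_congr fun hx => ?_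
    obtain ⟨g, -, -, -, -, -, hB, -⟩ := hx
    congr 1
    · refine Finset.prod_congr rfl fun z hz => ?_
      rw [h1 z ⟨(mem_trace.1 (hB hz)).1, (mem_trace.1 (hB hz)).2.1⟩]
    · simp only [hH]
      rw [lastPassage_congr (u := u₀) fun z _ hz => h2 z (by
          simp only [Set.mem_ofPred_eq, hp] at hz ⊢; omega),
        lastPassage_congr (v := v₀) fun z hz _ => h2 z (by
          simp only [Set.mem_ofPred_eq, hq] at hz ⊢; omega)])
  calc (∫⁻ ω, expSup lam (crossings t₀ t₁ α β h) ω ∂fieldLaw ν) *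
        ENNReal.ofReal (Real.exp (lam * (2 * M)))
      = ∫⁻ ω, expSup lam (crossings t₀ t₁ α β h) ω *
        ENNReal.ofReal (Real.exp (lam * (2 * M))) ∂fieldLaw ν :=
        (lintegral_mul_const _ (measurable_expSup lam _)).symm
    _ ≤ ∫⁻ ω, ∫⁻ ω', f ω ω' ∂fieldLaw ν ∂fieldLaw ν := by
        refine lintegral_mono fun ω => ?_
        simp only [expSup]
        simp_rw [ENNReal.iSup_mul]
        refine iSup₂_le ?_
        rintro B ⟨g, hg, h1, h2, h3, h4, hB⟩
        set x : Finset (ℤ × ℤ) × ℤ × ℤ := (B, g t₀, g t₁) with hx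
        have hxT : x ∈ T := ⟨g, hg, h1, h2, h3, h4, hB, rfl, rfl⟩
        obtain ⟨i1, m1⟩ := hM u₀ (p x) (by
            simp only [hu₀, hp, hx, Prod.mk_le_mk]; omega) (by
            simp only [hu₀, hp, hx]; ring) (by
            simp only [hu₀, hp, hx, abs_le]; omega)
        obtain ⟨i2, m2⟩ := hM (q x) v₀ (by
            simp only [hv₀, hq, hx, Prod.mk_le_mk]; omega) (by
            simp only [hv₀, hq, hx]; ring) (by
            simp only [hv₀, hq, hx, abs_le]; omega)
        -- The legs avoid the levels of the crossing. With the crossing held fixed, Jensen bounds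
        -- their exponential moment below; only afterwards is the supremum moved inside the
        -- integral.
        have hJ := ofReal_exp_integral_le (fieldLaw ν) ((i1.add i2).const_mul lam)
        have hmean : lam * (2 * M) ≤ ∫ ω, lam * (lastPassage u₀ (p x) + lastPassage (q x) v₀) ω
            ∂fieldLaw ν := by
          rw [integral_const_mul]
          refine mul_le_mul_of_nonneg_left ?_ hlam
          rw [integral_add' i1 i2]; linarith
        calc _ ≤ (∏ z ∈ x.1, ENNReal.ofReal (Real.exp (lam * ω z))) *
              ∫⁻ ω', ENNReal.ofReal (Real.exp (H x ω')) ∂fieldLaw ν := by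
              refine mul_le_mul_right ?_ _
              exact (ENNReal.ofReal_le_ofReal (Real.exp_le_exp.2 hmean)).trans hJ
          _ = ∫⁻ ω', (∏ z ∈ x.1, ENNReal.ofReal (Real.exp (lam * ω z))) *
              ENNReal.ofReal (Real.exp (H x ω')) ∂fieldLaw ν :=
              (lintegral_const_mul _ (hHm x)).symm
          _ ≤ _ := lintegral_mono fun ω' =>
              le_iSup₂ (f := fun (x : Finset (ℤ × ℤ) × ℤ × ℤ) (_ : x ∈ T) =>
                (∏ z ∈ x.1, ENNReal.ofReal (Real.exp (lam * ω z))) *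
                  ENNReal.ofReal (Real.exp (H x ω'))) x hxT
    _ = ∫⁻ ω, f ω ω ∂fieldLaw ν := key.symm
    _ ≤ _ := by
        refine lintegral_mono_ae ?_
        filter_upwards [ae_nonneg_weights hν] with ω hω
        refine iSup₂_le ?_
        rintro ⟨B, a, b⟩ ⟨g, hg, h1, h2, h3, h4, hB, ha, hb⟩
        simp only at hB ha hb
        subst ha hb
        rw [expWeight_eq, ← ENNReal.ofReal_mul (Real.exp_pos _).le, ← Real.exp_add]
        refine ENNReal.ofReal_le_ofReal (Real.exp_le_exp.2 ?_)
        simp only [hH, hp, hq, ← mul_add]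
        refine mul_le_mul_of_nonneg_left ?_ hlam
        have w1 : ∑ z ∈ B, ω z ≤ lastPassage (site g t₀) (site g t₁) ω :=
          (Finset.sum_le_sum_of_subset_of_nonneg hB fun z _ _ => hω z).trans
            (hg.sum_le_lastPassage ht ω)
        have hg' := hg.le_of_le ht
        have w2 := lastPassage_add_le hω (u := u₀) (v := (g t₀ - 1, t₀ - g t₀))
          (u' := site g t₀) (v' := site g t₁)
          (by simp only [hu₀, Prod.mk_le_mk]; omega)
          (by simp only [site, Prod.mk_le_mk]; omega)
          (by simp only [site, Prod.mk_le_mk]; omega)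
          (by simp only [site]; omega)
        have w3 := lastPassage_add_le hω (u := u₀) (v := site g t₁)
          (u' := (g t₁ + 1, t₁ - g t₁ + 1)) (v' := v₀)
          (by simp only [hu₀, site, Prod.mk_le_mk]; omega)
          (by simp only [hv₀, Prod.mk_le_mk]; omega)
          (by simp only [site, Prod.mk_le_mk]; omega)
          (by simp only [site]; omega)
        linarith

end Crossing

/-! ### The deficit of a block crossing -/

section CrossingBound

theorem passageMGF_le_of_sq_le {ν : Measure ℝ} {lam E : ℝ} {u v : ℤ × ℤ}
    (h : passageMGF ν lam u v ^ 2 ≤ ENNReal.ofReal (Real.exp E)) :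
    passageMGF ν lam u v ≤ ENNReal.ofReal (Real.exp (E / 2)) := by
  have : ENNReal.ofReal (Real.exp E) = ENNReal.ofReal (Real.exp (E / 2)) ^ 2 := by
    rw [← ENNReal.ofReal_pow (Real.exp_pos _).le, ← Real.exp_nat_mul]
    congr 2; push_cast; ring
  rw [this] at h
  exact le_of_not_gt fun hlt => absurd h (not_le.2 (ENNReal.pow_right_strictMono two_ne_zero hlt))

theorem rpow_one_third_cube {x : ℝ} (hx : 0 ≤ x) : (x ^ (1 / 3 : ℝ)) ^ 3 = x := by
  rw [← Real.rpow_natCast, ← Real.rpow_mul hx]; norm_num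

theorem rpow_two_thirds_eq_sq {x : ℝ} (hx : 0 ≤ x) : x ^ (2 / 3 : ℝ) = (x ^ (1 / 3 : ℝ)) ^ 2 := by
  rw [← Real.rpow_natCast, ← Real.rpow_mul hx]; norm_num

set_option maxHeartbeats 1600000 in
/-- Crossings of a block of height `r` between short intervals have exponential moments strictly
smaller than the deterministic growth. -/
theorem exists_crossing_bound {ν : Measure ℝ} [IsProbabilityMeasure ν] (hν : ν (Set.Iio 0) = 0) {μ : ℝ} (hμ : HasGrowthRate ν μ)
    (hshape : LimitShapeAssumption ν μ) (htail : TailAssumption ν) :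
    ∃ η s₁ g : ℝ, 0 < η ∧ 0 < s₁ ∧ 0 < g ∧ ∃ r₁ : ℝ, 1 ≤ r₁ ∧ ∀ r : ℕ, r₁ ≤ r → ∀ h : ℤ,
      0 ≤ h → (h : ℝ) ≤ η * (r : ℝ) ^ (2 / 3 : ℝ) → ∀ lam : ℝ, 0 ≤ lam →
      lam * (r : ℝ) ^ (1 / 3 : ℝ) ≤ s₁ → ∀ t₀ α β : ℤ,
        ∫⁻ ω, expSup lam (crossings t₀ (t₀ + 2 * r - 1) α β h) ω ∂fieldLaw ν ≤
          ENNReal.ofReal (Real.exp (lam * (μ * r) - g * (lam * (r : ℝ) ^ (1 / 3 : ℝ)))) := by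
  obtain ⟨g, C, s₀, hg, hC, hs₀, R₀, hdiag⟩ := exists_diagonal_mgf_bound hμ hshape htail
  obtain ⟨ρ, G₁, g₁, hρ, hρ1, hG₁, hg₁, r₀, hmean⟩ := exists_integral_lastPassage_ge hshape
  -- With x = r^{1/3}, legs of scale τ ≈ ζr satisfy τ^{1/3} ≤ κx. Then κ and η are chosen so that
  -- the fluctuation loss of the two legs together is at most gx/8 and so is their transverse loss.
  set κ : ℝ := min 1 (g / (16 * g₁)) with hκ
  have hκ0 : 0 < κ := by positivity
  have hκ1 : κ ≤ 1 := min_le_left _ _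
  have hκg : 2 * g₁ * κ ≤ g / 8 := by
    have : κ ≤ g / (16 * g₁) := min_le_right _ _
    rw [le_div_iff₀ (by positivity)] at this
    linarith
  set ζ : ℝ := κ ^ 3 / 2 with hζ
  have hζ0 : 0 < ζ := by positivity
  have hζ1 : ζ ≤ 1 / 2 := by
    have : κ ^ 3 ≤ 1 := pow_le_one₀ hκ0.le hκ1
    rw [hζ]; linarith
  set η : ℝ := Real.sqrt (g * ζ / (16 * G₁)) with hη
  have hη0 : 0 < η := Real.sqrt_pos.2 (by positivity)
  have hη2 : η ^ 2 = g * ζ / (16 * G₁) := Real.sq_sqrt (by positivity)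
  refine ⟨η, min (s₀ / 3) (g / (36 * C)), g / 8, hη0, by positivity, by positivity,
    max (max R₀ ((r₀ : ℝ) / ζ)) (max (1 / ζ) ((η / (ρ * ζ)) ^ 3 + 1)), ?_, ?_⟩
  · refine le_max_of_le_right (le_max_of_le_right ?_)
    have : 0 < (η / (ρ * ζ)) ^ 3 := by positivity
    linarith
  intro r hr h hh0 hh lam hlam hlamr t₀ α β
  simp only [max_le_iff] at hr
  obtain ⟨⟨hrR, hrr₀⟩, hrζ, hrη⟩ := hr
  rw [div_le_iff₀ hζ0] at hrr₀ hrζ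
  set x : ℝ := (r : ℝ) ^ (1 / 3 : ℝ) with hx
  have hr0 : (0 : ℝ) ≤ r := Nat.cast_nonneg r
  have hx0 : 0 ≤ x := by positivity
  have hx3 : x ^ 3 = r := rpow_one_third_cube hr0
  rw [rpow_two_thirds_eq_sq hr0, ← hx] at hh
  have hxη : η / (ρ * ζ) ≤ x := by
    refine le_of_pow_le_pow_left₀ (n := 3) (by norm_num) hx0 ?_
    rw [hx3]; linarith
  have hxpos : 0 < x := lt_of_lt_of_le (by positivity) hxη
  rw [div_le_iff₀ (by positivity)] at hxη
  have hrpos : (0 : ℝ) < r := by rw [← hx3]; positivity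
  set τ : ℕ := ⌈ζ * r⌉₊ with hτ
  have hτ1 : ζ * r ≤ τ := Nat.le_ceil _
  have hτ2 : (τ : ℝ) ≤ 2 * ζ * r := by
    have := Nat.ceil_lt_add_one (show 0 ≤ ζ * (r : ℝ) by positivity)
    rw [← hτ] at this
    nlinarith
  have hτpos : (0 : ℝ) < τ := lt_of_lt_of_le (by positivity) hτ1
  have hτN : 1 ≤ τ := by exact_mod_cast Nat.one_le_iff_ne_zero.2 (by
    rintro h0; rw [h0] at hτpos; simp at hτpos)
  have hτr₀ : r₀ ≤ τ := by exact_mod_cast (show (r₀ : ℝ) ≤ τ by nlinarith)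
  have hhρ : (h : ℝ) ≤ ρ * τ := by
    calc (h : ℝ) ≤ η * x ^ 2 := hh
      _ ≤ x * (ρ * ζ) * x ^ 2 := by gcongr
      _ = ρ * (ζ * x ^ 3) := by ring
      _ ≤ ρ * τ := by rw [hx3]; gcongr
  have hhτ : h ≤ (τ : ℤ) := by
    have : (h : ℝ) ≤ (τ : ℝ) := hhρ.trans (by nlinarith)
    exact_mod_cast this
  set M : ℝ := μ * τ - G₁ * (h : ℝ) ^ 2 / τ - g₁ * (τ : ℝ) ^ (1 / 3 : ℝ) with hM
  have hback := lintegral_expSup_crossings_mul_le hν hlam (t₀ := t₀) (t₁ := t₀ + 2 * r - 1)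
    (α := α) (β := β) (h := h) (τ := τ) (by
      have : 0 < r := by exact_mod_cast hrpos
      omega) hhτ (M := M) (by
      intro u v huv hlev habs
      refine ⟨integrable_lastPassage hν hμ huv, hmean τ hτr₀ hτN u v (by exact_mod_cast hlev) h ?_
        hhρ⟩
      exact_mod_cast habs)
  have hMge : -(g / 4 * x) ≤ 2 * (M - μ * τ) := by
    have a1 : G₁ * (h : ℝ) ^ 2 / τ ≤ g / 16 * x := by
      rw [div_le_iff₀ hτpos]
      calc G₁ * (h : ℝ) ^ 2 ≤ G₁ * (η * x ^ 2) ^ 2 := by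
            have : (0 : ℝ) ≤ h := by exact_mod_cast hh0
            gcongr
        _ = G₁ * η ^ 2 * x * x ^ 3 := by ring
        _ = g / 16 * x * (ζ * r) := by rw [hη2, hx3]; field_simp
        _ ≤ g / 16 * x * τ := by gcongr
    have a2 : (τ : ℝ) ^ (1 / 3 : ℝ) ≤ κ * x := by
      refine le_of_pow_le_pow_left₀ (n := 3) (by norm_num) (by positivity) ?_
      rw [rpow_one_third_cube hτpos.le, mul_pow, hx3]
      refine hτ2.trans (le_of_eq ?_)
      rw [hζ]; ring
    have a3 : 2 * (g₁ * (τ : ℝ) ^ (1 / 3 : ℝ)) ≤ g / 8 * x := by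
      calc 2 * (g₁ * (τ : ℝ) ^ (1 / 3 : ℝ)) ≤ 2 * (g₁ * (κ * x)) := by gcongr
        _ = 2 * g₁ * κ * x := by ring
        _ ≤ _ := by gcongr
    rw [hM]; linarith
  -- An empty class has supremum 0. Otherwise any crossing shows that the two fixed endpoints are
  -- comparable.
  rcases (crossings t₀ (t₀ + 2 * r - 1) α β h).eq_empty_or_nonempty with hemp | ⟨B, hB⟩
  · simp [hemp, expSup]
  set R : ℕ := r + 2 * τ with hR
  set y : ℝ := ((2 * R : ℕ) : ℝ) ^ (1 / 3 : ℝ) with hy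
  have hy0 : 0 ≤ y := by positivity
  have hy3 : y ^ 3 = 2 * r + 4 * τ := by
    rw [hy, rpow_one_third_cube (Nat.cast_nonneg _), hR]; push_cast; ring
  have hτ3 : (τ : ℝ) ≤ r := by nlinarith
  have hxy : x ≤ y := by
    refine le_of_pow_le_pow_left₀ (n := 3) (by norm_num) hy0 ?_
    rw [hx3, hy3]; linarith
  have hyx : y ≤ 3 * x := by
    refine le_of_pow_le_pow_left₀ (n := 3) (by norm_num) (by positivity) ?_
    rw [mul_pow, hx3, hy3]; linarith
  have hs1 : lam * x ≤ s₀ / 3 := hlamr.trans (min_le_left _ _)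
  have hs2 : lam * x ≤ g / (36 * C) := hlamr.trans (min_le_right _ _)
  have hd := hdiag (2 * R) (by
    have : (R₀ : ℝ) ≤ r := hrR
    have : R₀ ≤ r := by exact_mod_cast this
    omega) lam hlam (by
    rw [← hy]
    calc lam * y ≤ lam * (3 * x) := by gcongr
      _ ≤ s₀ := by linarith)
  rw [← hy] at hd
  obtain ⟨f, hf, f1, f2, f3, f4, -⟩ := hB
  have hf' := hf.le_of_le (show t₀ ≤ t₀ + 2 * r - 1 by
    have : 0 < r := by exact_mod_cast hrpos
    omega)
  have hsq := passageMGF_sq_le hν hlam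
    (u := (α - τ, t₀ + 1 - τ - α)) (v := (β + τ, t₀ + 2 * r - 1 + τ - β))
    (by simp only [Prod.mk_le_mk]; omega) (R := R)
    (by simp only [hR]; push_cast; ring)
  have hfin := hback.trans (passageMGF_le_of_sq_le (hsq.trans hd))
  have hdiv : ∀ {I : ℝ≥0∞} {a b : ℝ}, I * ENNReal.ofReal (Real.exp a) ≤
      ENNReal.ofReal (Real.exp b) → I ≤ ENNReal.ofReal (Real.exp (b - a)) := by
    intro I a b hI
    have : I * ENNReal.ofReal (Real.exp a) * ENNReal.ofReal (Real.exp (-a)) ≤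
      ENNReal.ofReal (Real.exp b) * ENNReal.ofReal (Real.exp (-a)) := mul_le_mul_left hI _
    rwa [mul_assoc, ← ENNReal.ofReal_mul (Real.exp_pos _).le,
      ← ENNReal.ofReal_mul (Real.exp_pos _).le, ← Real.exp_add, ← Real.exp_add, add_neg_cancel,
      Real.exp_zero, ENNReal.ofReal_one, mul_one, ← sub_eq_add_neg] at this
  refine (hdiv hfin).trans (ENNReal.ofReal_le_ofReal (Real.exp_le_exp.2 ?_))
  have hRR : ((2 * R : ℕ) : ℝ) = 2 * r + 4 * τ := by rw [hR]; push_cast; ring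
  rw [hRR]
  -- In units of lam·x, the square root from the reflection leaves a gain g/2; the quadratic term
  -- costs g/8 and the legs g/4, so g/8 remains.
  have q1 : C * (lam * y) ^ 2 ≤ g / 4 * (lam * x) := by
    have hl : 0 ≤ lam * x := by positivity
    calc C * (lam * y) ^ 2 ≤ C * (lam * (3 * x)) ^ 2 := by gcongr
      _ = 9 * C * (lam * x) * (lam * x) := by ring
      _ ≤ 9 * C * (g / (36 * C)) * (lam * x) := by gcongr
      _ = _ := by field_simp; ring
  have q2 : lam * (g * x) ≤ lam * (g * y) := by gcongr
  have q3 : lam * (-(g / 4 * x)) ≤ lam * (2 * (M - μ * τ)) := by gcongr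
  linarith

end CrossingBound

/-! ### Uncrossing the paths and counting end cells -/

section Uncrossing

/-- Finitely many climbs may be uncrossed: the order statistics of their positions are climbs. -/
theorem exists_sorted_climbs {k : ℕ} (f : Fin k → ℤ → ℤ) (hf : ∀ i, IsClimb (f i)) :
    ∃ F : Fin k → ℤ → ℤ, (∀ i, IsClimb (F i)) ∧ (∀ t, Monotone fun i => F i t) ∧
      ∀ t, ∃ σ : Equiv.Perm (Fin k), ∀ i, F i t = f (σ i) t := by
  set σ : ℤ → Equiv.Perm (Fin k) := fun t => Tuple.sort fun i => f i t
  set F : Fin k → ℤ → ℤ := fun i t => f (σ t i) t with hF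
  have hmono : ∀ t, Monotone fun i => F i t := fun t => Tuple.monotone_sort fun i => f i t
  have hcard : ∀ t a, Finset.card {i | F i t ≤ a} = Finset.card {i | f i t ≤ a} := fun t a =>
    Finset.card_equiv (σ t) (by simp [hF])
  -- The i-th order statistic (from 0) is at most a exactly when more than i values are. Comparing
  -- such counts on consecutive levels gives the step condition.
  have key : ∀ t (i : Fin k) a, (i : ℕ) < Finset.card {i | f i t ≤ a} ↔ F i t ≤ a := by
    intro t i a
    rw [← hcard]
    exact Tuple.lt_card_le_iff_apply_le_of_monotone (f := fun i => F i t) (a := a) (j := i) (hmono t)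
  refine ⟨F, fun i t => ?_, hmono, fun t => ⟨σ t, fun i => rfl⟩⟩
  have h1 : F i (t + 1) ≤ F i t + 1 := by
    rw [← key]
    refine lt_of_lt_of_le ((key t i (F i t)).2 le_rfl) (Finset.card_le_card fun j hj => ?_)
    simp only [Finset.mem_filter, Finset.mem_univ, true_and] at hj ⊢
    rcases hf j t with h | h <;> omega
  have h2 : F i t ≤ F i (t + 1) := by
    rw [← key]
    refine lt_of_lt_of_le ((key (t + 1) i (F i (t + 1))).2 le_rfl)
      (Finset.card_le_card fun j hj => ?_)
    simp only [Finset.mem_filter, Finset.mem_univ, true_and] at hj ⊢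
    rcases hf j t with h | h <;> omega
  omega

/-- The monotone maps from `Fin k` to `Fin N`. -/
def monotoneMaps (k N : ℕ) : Finset (Fin k → Fin N) := by
  classical exact Finset.univ.filter Monotone

theorem mem_monotoneMaps {k N : ℕ} {a : Fin k → Fin N} : a ∈ monotoneMaps k N ↔ Monotone a := by
  simp [monotoneMaps]

/-- A monotone map is determined by the multiset of its values. -/
theorem card_monotoneMaps_le (k N : ℕ) : (monotoneMaps k N).card ≤ (N + k - 1).choose k := by
  classical
  have h := Sym.card_sym_eq_choose (α := Fin N) k
  rw [Fintype.card_fin] at h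
  rw [← h, ← Finset.card_univ]
  refine Finset.card_le_card_of_injOn
    (fun a => (⟨(List.ofFn a : Multiset (Fin N)), by simp⟩ : Sym (Fin N) k))
    (fun _ _ => Finset.mem_coe.2 (Finset.mem_univ _)) ?_
  intro a ha b hb hab
  rw [Finset.mem_coe, mem_monotoneMaps] at ha hb
  have hp : (List.ofFn a).Perm (List.ofFn b) := Multiset.coe_eq_coe.1 (congrArg Subtype.val hab)
  exact List.ofFn_injective
    (hp.eq_of_pairwise' ha.sortedLE_ofFn.pairwise hb.sortedLE_ofFn.pairwise)

theorem exists_block {T : ℕ → ℤ} {m : ℕ} {x : ℤ} (h0 : T 0 ≤ x) (hm : x < T m) :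
    ∃ j : Fin m, T j ≤ x ∧ x < T (j + 1) := by
  induction m with
  | zero => omega
  | succ m ih =>
    rcases lt_or_ge x (T m) with h | h
    · obtain ⟨j, hj⟩ := ih h
      exact ⟨j.castSucc, hj⟩
    · exact ⟨Fin.last m, h, hm⟩

/-- The left end of the window of half-width `D` around the diagonal on level `s`. -/
def windowBase (D s : ℤ) : ℤ := (s - D) / 2

/-- The class of all disjoint families of crossings of the successive blocks between the levels
`T j` and `T (j + 1) - 1`, with prescribed end cells. -/
def blockFamilies {k N m : ℕ} (T : ℕ → ℤ) (D h : ℤ)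
    (τ : Fin m → (Fin k → Fin N) × (Fin k → Fin N)) : Set (Finset (ℤ × ℤ)) :=
  disjointFamilyUnions (Finset.univ : Finset (Fin m × Fin k)) fun p =>
    crossings (T p.1) (T (p.1 + 1) - 1) (windowBase D (T p.1) + ((τ p.1).1 p.2 : ℕ) * h)
      (windowBase D (T (p.1 + 1) - 1) + ((τ p.1).2 p.2 : ℕ) * h) h

theorem exists_cells {k N : ℕ} {D h : ℤ} (hh : 0 < h) (hD : D < N * h) {F : Fin k → ℤ}
    (hF : Monotone F) (s : ℤ) (hs : ∀ i, |2 * F i - s| ≤ D) :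
    ∃ a : Fin k → Fin N, Monotone a ∧ ∀ i, windowBase D s + ((a i : ℕ) : ℤ) * h ≤ F i ∧
      F i < windowBase D s + ((a i : ℕ) : ℤ) * h + h := by
  have h1 : ∀ i, 0 ≤ F i - windowBase D s ∧ F i - windowBase D s ≤ D := by
    intro i
    have := abs_le.1 (hs i)
    unfold windowBase
    omega
  have h2 : ∀ i, 0 ≤ (F i - windowBase D s) / h := fun i => Int.ediv_nonneg (h1 i).1 hh.le
  have h3 : ∀ i, (F i - windowBase D s) / h < N := fun i =>
    Int.ediv_lt_of_lt_mul hh ((h1 i).2.trans_lt hD)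
  refine ⟨fun i => ⟨((F i - windowBase D s) / h).toNat, by have := h2 i; have := h3 i; omega⟩,
    fun i j hij => ?_, fun i => ?_⟩
  · rw [Fin.mk_le_mk]
    exact Int.toNat_le_toNat (Int.ediv_le_ediv hh (by have := hF hij; omega))
  · have h4 := Int.mul_ediv_add_emod (F i - windowBase D s) h
    have h5 := Int.emod_nonneg (F i - windowBase D s) hh.ne'
    have h6 := Int.emod_lt_of_pos (F i - windowBase D s) hh
    simp only [Int.toNat_of_nonneg (h2 i)]
    rw [mul_comm h] at h4
    constructor <;> linarith

/-- Sorting only permutes positions within each level, so the union of the paths, with its total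
weight, is covered by the sorted climbs. Cutting it by block and by climb gives disjoint subsets of
crossings whose end cells are monotone in the index. -/
theorem exists_blockFamily_of_mem_event {μ : ℝ} {n k m N : ℕ} {δ C₃ : ℝ} {ω : Weights} (hk : 1 ≤ k)
    (hω : ω ∈ disjointPathsEvent μ n k δ C₃) {T : ℕ → ℤ} {D h : ℤ}
    (hT0 : T 0 ≤ 2) (hTm : 2 * (n : ℤ) < T m) (hh : 0 < h)
    (hW : δ * (k : ℝ) ^ (1 / 3 : ℝ) * (n : ℝ) ^ (2 / 3 : ℝ) + 1 ≤ D) (hD : D < N * h) :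
    ∃ τ : Fin m → (Fin k → Fin N) × (Fin k → Fin N),
      (∀ j, τ j ∈ monotoneMaps k N ×ˢ monotoneMaps k N) ∧ ∃ B ∈ blockFamilies T D h τ,
        k * (μ * n - C₃ * (k : ℝ) ^ (2 / 3 : ℝ) * (n : ℝ) ^ (1 / 3 : ℝ)) ≤ ∑ z ∈ B, ω z := by
  classical
  obtain ⟨γ, hdisj, hstrip, hwt⟩ := hω
  have : Nonempty (Fin k) := ⟨⟨0, hk⟩⟩
  choose f s e hf hse _ _ hverts hweight hnear using fun i => (γ i).exists_climb
  have hmemstrip : ∀ i, ∀ z ∈ trace (f i) (s i) (e i),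
      z ∈ strip n (δ * (k : ℝ) ^ (1 / 3 : ℝ) * (n : ℝ) ^ (2 / 3 : ℝ)) := fun i z hz =>
    hstrip i (by rw [hverts]; exact hz)
  have hfD : ∀ i t, |2 * f i t - t| ≤ D := by
    intro i t
    obtain ⟨t', h1, h2, h3⟩ := hnear i t
    have h4 := (hmemstrip i (site (f i) t') (by
      rw [mem_trace, site_level]; exact ⟨h1, h2, rfl⟩)).2.2
    have h5 : ((|2 * f i t' - t'| + 1 : ℤ) : ℝ) ≤ D := by
      refine le_trans ?_ hW
      push_cast
      refine add_le_add_left (le_trans (le_of_eq ?_) h4) 1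
      congr 1
      simp only [site]; push_cast; ring
    have h6 : |2 * f i t' - t'| + 1 ≤ D := by exact_mod_cast h5
    have h7 := abs_sub_abs_le_abs_sub (2 * f i t - t) (2 * f i t' - t')
    omega
  obtain ⟨F, hFc, hFm, hFσ⟩ := exists_sorted_climbs f hf
  have hFD : ∀ t i, |2 * F i t - t| ≤ D := fun t i => by
    obtain ⟨σ, hσ⟩ := hFσ t
    rw [hσ]; exact hfD _ _
  set B : Finset (ℤ × ℤ) := Finset.univ.biUnion fun i => trace (f i) (s i) (e i) with hB
  -- Sorted climbs may meet, since the prolongations need not be disjoint; choosing one owner per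
  -- vertex keeps the pieces disjoint.
  have hown : ∀ z, ∃ i, z ∈ B → z.1 = F i (z.1 + z.2) := by
    intro z
    by_cases hz : z ∈ B
    · obtain ⟨i, -, hi⟩ := Finset.mem_biUnion.1 hz
      obtain ⟨σ, hσ⟩ := hFσ (z.1 + z.2)
      refine ⟨σ.symm i, fun _ => ?_⟩
      rw [hσ, Equiv.apply_symm_apply]
      exact (mem_trace.1 hi).2.2
    · exact ⟨Classical.arbitrary _, fun h => absurd h hz⟩
  choose owner howner using hown
  have hblk : ∀ z ∈ B, ∃ j : Fin m, T j ≤ z.1 + z.2 ∧ z.1 + z.2 < T (j + 1) := by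
    intro z hz
    obtain ⟨i, -, hi⟩ := Finset.mem_biUnion.1 hz
    obtain ⟨h1, h2, -⟩ := hmemstrip i z hi
    exact exists_block (by omega) (by omega)
  have hblk' : ∀ z, ∃ j : Option (Fin m), z ∈ B → ∃ j', j = some j' ∧
      T j' ≤ z.1 + z.2 ∧ z.1 + z.2 < T (j' + 1) := by
    intro z
    by_cases hz : z ∈ B
    · obtain ⟨j, hj⟩ := hblk z hz
      exact ⟨some j, fun _ => ⟨j, rfl, hj⟩⟩
    · exact ⟨none, fun h => absurd h hz⟩
  choose blk hblk using hblk'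
  choose a ha1 ha2 using fun t => exists_cells hh hD (hFm t) t (hFD t)
  refine ⟨fun j => (a (T j), a (T (j + 1) - 1)), fun j => ?_, B, ?_, ?_⟩
  · rw [Finset.mem_product, mem_monotoneMaps, mem_monotoneMaps]
    exact ⟨ha1 _, ha1 _⟩
  · refine ⟨fun p => B.filter fun z => blk z = some p.1 ∧ owner z = p.2, ?_, ?_, ?_⟩
    · rintro ⟨j, i⟩ -
      have h1 := ha2 (T j) i
      have h2 := ha2 (T (j + 1) - 1) i
      refine ⟨F i, hFc i, h1.1, h1.2, h2.1, h2.2, fun z hz => ?_⟩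
      obtain ⟨hzB, hz1, hz2⟩ := Finset.mem_filter.1 hz
      obtain ⟨j', h3, h4, h5⟩ := hblk z hzB
      simp only at hz1 hz2
      rw [hz1, Option.some_inj] at h3
      subst h3 hz2
      exact mem_trace.2 ⟨h4, Int.le_sub_one_of_lt h5, howner z hzB⟩
    · rintro p - q - hpq
      rw [Finset.disjoint_left]
      intro z h1 h2
      obtain ⟨-, h3, h4⟩ := Finset.mem_filter.1 h1
      obtain ⟨-, h5, h6⟩ := Finset.mem_filter.1 h2
      exact hpq (Prod.ext (Option.some_inj.1 (h3.symm.trans h5)) (h4.symm.trans h6))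
    · ext z
      simp only [Finset.mem_biUnion, Finset.mem_univ, true_and, Finset.mem_filter]
      refine ⟨fun hz => ?_, fun ⟨_, hz, _⟩ => hz⟩
      obtain ⟨j', h3, -⟩ := hblk z hz
      exact ⟨(j', owner z), hz, h3, rfl⟩
  · rw [hB, Finset.sum_biUnion]
    · calc _ = ∑ _i : Fin k, (μ * n - C₃ * (k : ℝ) ^ (2 / 3 : ℝ) * (n : ℝ) ^ (1 / 3 : ℝ)) := by
            rw [Finset.sum_const, Finset.card_univ, Fintype.card_fin, nsmul_eq_mul]
        _ ≤ _ := Finset.sum_le_sum fun i _ => by rw [← hweight]; exact hwt i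
    · intro i _ j _ hij
      have := hdisj i j hij
      rw [hverts, hverts] at this
      exact Finset.disjoint_coe.1 this

end Uncrossing

/-! ### Chernoff bound, entropy and block lengths -/

section Assembly

/-- Markov's inequality for the supremum over all families, with a union bound over the end cells of
the m blocks: two monotone maps per block give the entropy 2mq, and each of the km crossings
contributes the deficit c. -/
theorem measureReal_disjointPathsEvent_le {ν : Measure ℝ} [IsProbabilityMeasure ν] {μ : ℝ}
    {n k m N : ℕ} {δ C₃ : ℝ} (hk : 1 ≤ k) {t : ℕ → ℕ} (ht : Monotone t) (ht0 : t 0 = 0)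
    (htm : t m = n) {D h : ℤ} (hh : 0 < h)
    (hW : δ * (k : ℝ) ^ (1 / 3 : ℝ) * (n : ℝ) ^ (2 / 3 : ℝ) + 1 ≤ D) (hD : D < N * h)
    {lam c q : ℝ} (hlam : 0 ≤ lam) (hq : ((monotoneMaps k N).card : ℝ) ≤ Real.exp q)
    (hblock : ∀ j < m, ∀ t₀ α β : ℤ,
      ∫⁻ ω, expSup lam (crossings t₀ (t₀ + 2 * (t (j + 1) - t j : ℕ) - 1) α β h) ω ∂fieldLaw ν ≤
        ENNReal.ofReal (Real.exp (lam * (μ * (t (j + 1) - t j : ℕ)) - c))) :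
    (fieldLaw ν).real (disjointPathsEvent μ n k δ C₃) ≤
      Real.exp (2 * m * q - c * k * m +
        lam * (k * (C₃ * (k : ℝ) ^ (2 / 3 : ℝ) * (n : ℝ) ^ (1 / 3 : ℝ)))) := by
  classical
  -- The strip starts on level 2 and ends on level 2n, just below T m = 2n + 2.
  set T : ℕ → ℤ := fun j => 2 * t j + 2 with hT
  set X : ℝ := C₃ * (k : ℝ) ^ (2 / 3 : ℝ) * (n : ℝ) ^ (1 / 3 : ℝ) with hX
  set types : Finset (Fin m → (Fin k → Fin N) × (Fin k → Fin N)) :=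
    Fintype.piFinset fun _ => monotoneMaps k N ×ˢ monotoneMaps k N with htypes
  set 𝒞 : Set (Finset (ℤ × ℤ)) := ⋃ τ ∈ types, blockFamilies T D h τ with h𝒞
  set K : ℝ := k * (μ * n - X) with hK
  have hsub : disjointPathsEvent μ n k δ C₃ ⊆
      {ω | ENNReal.ofReal (Real.exp (lam * K)) ≤ expSup lam 𝒞 ω} := by
    intro ω hω
    obtain ⟨τ, hτ, B, hB, hw⟩ := exists_blockFamily_of_mem_event (m := m) hk hω (T := T)
      (by simp [hT, ht0]) (by simp [hT, htm]) hh hW hD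
    have hB𝒞 : B ∈ 𝒞 := Set.mem_biUnion (Finset.mem_coe.2 (Fintype.mem_piFinset.2 hτ)) hB
    refine le_trans ?_ (le_expSup hB𝒞 ω)
    rw [expWeight_eq]
    exact ENNReal.ofReal_le_ofReal (Real.exp_le_exp.2 (mul_le_mul_of_nonneg_left hw hlam))
  have hfam : ∀ τ : Fin m → (Fin k → Fin N) × (Fin k → Fin N),
      ∫⁻ ω, expSup lam (blockFamilies T D h τ) ω ∂fieldLaw ν ≤
        ENNReal.ofReal (Real.exp (k * (lam * (μ * n) - c * m))) := by
    intro τ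
    refine (lintegral_expSup_disjointFamilyUnions_le ν lam _ _
      fun p => crossings_bounded _ _ _ _ _).trans ?_
    have hle : ∀ p : Fin m × Fin k, ∫⁻ ω, expSup lam (crossings (T p.1) (T (p.1 + 1) - 1)
        (windowBase D (T p.1) + ((τ p.1).1 p.2 : ℕ) * h)
        (windowBase D (T (p.1 + 1) - 1) + ((τ p.1).2 p.2 : ℕ) * h) h) ω ∂fieldLaw ν ≤
        ENNReal.ofReal (Real.exp (lam * (μ * (t (p.1 + 1) - t p.1 : ℕ)) - c)) := by
      intro p
      have e : T (p.1 + 1) - 1 = T p.1 + 2 * (t (p.1 + 1) - t p.1 : ℕ) - 1 := by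
        have := ht (Nat.le_succ p.1)
        simp only [hT]; push_cast [this]; ring
      rw [e]
      exact hblock p.1 p.1.2 _ _ _
    refine (Finset.prod_le_prod' fun p _ => hle p).trans (le_of_eq ?_)
    rw [← ENNReal.ofReal_prod_of_nonneg fun _ _ => (Real.exp_pos _).le, ← Real.exp_sum,
      Fintype.sum_prod_type]
    congr 2
    simp only [Finset.sum_const, Finset.card_univ, Fintype.card_fin, nsmul_eq_mul]
    rw [← Finset.mul_sum, Finset.sum_sub_distrib, ← Finset.mul_sum, ← Finset.mul_sum,
      Fin.sum_univ_eq_sum_range (fun j => ((t (j + 1) - t j : ℕ) : ℝ)) m, ← Nat.cast_sum,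
      Finset.sum_range_tsub ht, ht0, htm]
    simp; left; ring
  have hint : ∫⁻ ω, expSup lam 𝒞 ω ∂fieldLaw ν ≤
      ENNReal.ofReal (Real.exp (2 * m * q + k * (lam * (μ * n) - c * m))) := by
    calc ∫⁻ ω, expSup lam 𝒞 ω ∂fieldLaw ν
        ≤ ∫⁻ ω, ∑ τ ∈ types, expSup lam (blockFamilies T D h τ) ω ∂fieldLaw ν := by
          refine lintegral_mono fun ω => iSup₂_le fun B hB => ?_
          obtain ⟨τ, hτ, hBτ⟩ := Set.mem_iUnion₂.1 hB
          exact (le_expSup hBτ ω).trans (Finset.single_le_sum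
            (f := fun τ => expSup lam (blockFamilies T D h τ) ω) (fun _ _ => zero_le) hτ)
      _ = ∑ τ ∈ types, ∫⁻ ω, expSup lam (blockFamilies T D h τ) ω ∂fieldLaw ν :=
          lintegral_finsetSum _ fun τ _ => measurable_expSup lam _
      _ ≤ ∑ _τ ∈ types, ENNReal.ofReal (Real.exp (k * (lam * (μ * n) - c * m))) :=
          Finset.sum_le_sum fun τ _ => hfam τ
      _ = ENNReal.ofReal ((types.card : ℝ) * Real.exp (k * (lam * (μ * n) - c * m))) := by
          rw [Finset.sum_const, nsmul_eq_mul, ENNReal.ofReal_mul (Nat.cast_nonneg _),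
            ENNReal.ofReal_natCast]
      _ ≤ _ := by
          rw [Real.exp_add]
          gcongr
          rw [htypes, Fintype.card_piFinset]
          simp only [Finset.card_product, Finset.prod_const, Finset.card_univ, Fintype.card_fin]
          push_cast
          calc _ ≤ (Real.exp q * Real.exp q) ^ m := by gcongr
            _ = _ := by rw [← Real.exp_add, ← Real.exp_nat_mul]; congr 1; ring
  have hmarkov : ENNReal.ofReal (Real.exp (lam * K)) *
      fieldLaw ν (disjointPathsEvent μ n k δ C₃) ≤
      ENNReal.ofReal (Real.exp (2 * m * q + k * (lam * (μ * n) - c * m))) :=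
    (mul_le_mul_right (measure_mono hsub) _).trans
      ((mul_meas_ge_le_lintegral (measurable_expSup lam 𝒞) _).trans hint)
  rw [← ofReal_measureReal, ← ENNReal.ofReal_mul (Real.exp_pos _).le,
    ENNReal.ofReal_le_ofReal_iff (Real.exp_pos _).le] at hmarkov
  have e : Real.exp (2 * m * q - c * k * m + lam * (k * X)) =
      Real.exp (2 * m * q + k * (lam * (μ * n) - c * m)) / Real.exp (lam * K) := by
    rw [← Real.exp_sub]; congr 1; rw [hK]; ring
  rw [e, le_div_iff₀ (Real.exp_pos _), mul_comm]
  exact hmarkov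

/-- Monotone maps into few cells have small entropy. -/
theorem exists_card_monotoneMaps_le_exp {c : ℝ} (hc : 0 < c) :
    ∃ ε : ℝ, 0 < ε ∧ ∀ k : ℕ,
      ((monotoneMaps k (⌊ε * k⌋₊ + 1)).card : ℝ) ≤ Real.exp (c * k) := by
  -- The binomial theorem at y = e^{−L} gives C(M+k, M) ≤ exp(y(M+k) + ML). Here L makes y ≤ c/4 and
  -- ε makes ML ≤ ck/2.
  set L : ℝ := 4 / c with hL
  have hL0 : 0 < L := by positivity
  set ε : ℝ := min 1 (c / (2 * L)) with hε
  have hε0 : 0 < ε := by positivity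
  refine ⟨ε, hε0, fun k => ?_⟩
  set M := ⌊ε * k⌋₊ with hM
  have hM1 : (M : ℝ) ≤ ε * k := Nat.floor_le (by positivity)
  have hMk : (M : ℝ) ≤ k := hM1.trans (by
    have : ε * (k : ℝ) ≤ 1 * k := by gcongr; exact min_le_left _ _
    linarith)
  have hML : (M : ℝ) * L ≤ c / 2 * k := by
    calc (M : ℝ) * L ≤ ε * k * L := by gcongr
      _ ≤ c / (2 * L) * k * L := by gcongr; exact min_le_right _ _
      _ = _ := by field_simp
  set y : ℝ := Real.exp (-L) with hy
  have hy0 : 0 < y := Real.exp_pos _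
  have hyc : y ≤ c / 4 := by
    rw [hy, Real.exp_neg, inv_le_comm₀ (Real.exp_pos _) (by positivity), inv_div]
    linarith [Real.add_one_le_exp L]
  have h1 : ((M + k).choose k : ℝ) * y ^ M ≤ (y + 1) ^ (M + k) := by
    rw [add_pow]
    have := Finset.single_le_sum
      (f := fun i => y ^ i * 1 ^ (M + k - i) * ((M + k).choose i : ℝ))
      (fun i _ => by positivity) (Finset.mem_range.2 (show M < M + k + 1 by omega))
    refine le_trans (le_of_eq ?_) this
    rw [one_pow, mul_one, mul_comm, Nat.choose_symm_add]
  have h2 : (y + 1) ^ (M + k) ≤ Real.exp (y * (M + k)) := by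
    calc (y + 1) ^ (M + k) ≤ Real.exp y ^ (M + k) := by gcongr; exact Real.add_one_le_exp y
      _ = _ := by rw [← Real.exp_nat_mul]; congr 1; push_cast; ring
  have h3 : y ^ M = Real.exp (-(M * L)) := by
    rw [hy, ← Real.exp_nat_mul]; congr 1; ring
  have hcard : ((monotoneMaps k (M + 1)).card : ℝ) ≤ ((M + k).choose k : ℝ) := by
    have := card_monotoneMaps_le k (M + 1)
    rw [show M + 1 + k - 1 = M + k by omega] at this
    exact_mod_cast this
  refine hcard.trans ?_
  have h4 : ((M + k).choose k : ℝ) ≤ Real.exp (y * (M + k)) * Real.exp (M * L) := by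
    have h5 := mul_le_mul_of_nonneg_right (h1.trans h2) (Real.exp_pos (M * L)).le
    rw [h3, mul_assoc, ← Real.exp_add, neg_add_cancel, Real.exp_zero, mul_one] at h5
    exact h5
  refine h4.trans ?_
  rw [← Real.exp_add]
  refine Real.exp_le_exp.2 ?_
  have h6 : y * (M + k) ≤ c / 4 * (k + k) := by gcongr
  linarith

/-- The lengths of the pieces when `n` is divided as evenly as possible into `m` parts. -/
theorem div_step_bounds {n m : ℕ} (hm : 0 < m) (j : ℕ) :
    (n : ℝ) / m - 1 ≤ (((j + 1) * n / m - j * n / m : ℕ) : ℝ) ∧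
      (((j + 1) * n / m - j * n / m : ℕ) : ℝ) ≤ (n : ℝ) / m + 1 := by
  have hle : j * n / m ≤ (j + 1) * n / m := Nat.div_le_div_right (by gcongr; omega)
  have hm' : (0 : ℝ) < m := by exact_mod_cast hm
  have f1 : ∀ a : ℕ, ((a / m : ℕ) : ℝ) ≤ (a : ℝ) / m := fun a => Nat.cast_div_le
  have f2 : ∀ a : ℕ, (a : ℝ) / m - 1 ≤ ((a / m : ℕ) : ℝ) := fun a => by
    rw [sub_le_iff_le_add, div_le_iff₀ hm']
    exact_mod_cast (Nat.lt_succ_iff.1 (Nat.lt_succ_of_lt (Nat.lt_mul_of_div_lt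
      (Nat.lt_succ_self (a / m)) hm)))
  have g1 := f1 (j * n)
  have g2 := f2 (j * n)
  have g3 := f1 ((j + 1) * n)
  have g4 := f2 ((j + 1) * n)
  have e : (((j + 1) * n : ℕ) : ℝ) / m = ((j * n : ℕ) : ℝ) / m + n / m := by
    push_cast; ring
  rw [Nat.cast_sub hle]
  constructor <;> linarith

end Assembly

end LPP

end

/-! ### Choice of the parameters -/

theorem theoremt (ν : MeasureTheory.Measure ℝ) [MeasureTheory.IsProbabilityMeasure ν]
    (hν : ν (Set.Iio 0) = 0) (hν₀ : ν {0} = 0)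
    (μ : ℝ) (hμ : LPP.HasGrowthRate ν μ)
    (hshape : LPP.LimitShapeAssumption ν μ) (htail : LPP.TailAssumption ν) :
    ∃ c : ℝ, 0 < c ∧ ∀ C₃ : ℝ, 0 < C₃ → ∃ δ c₁ : ℝ, 0 < δ ∧ 0 < c₁ ∧
      ∀ n k : ℕ, 1 ≤ k → (k : ℝ) ≤ c₁ * n →
        (LPP.fieldLaw ν).real (LPP.disjointPathsEvent μ n k δ C₃) ≤
          Real.exp (-c * (k : ℝ) ^ 2) := by
  obtain ⟨η, s₁, g, hη, hs₁, hg, r₁, hr₁, hcross⟩ :=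
    LPP.exists_crossing_bound hν hμ hshape htail
  -- Below, r^{1/3} lies within a factor 2 of l/a, where l = (n/k)^{1/3}. With lam = sa/l, half of
  -- s₁ keeps lam·r^{1/3} ≤ s₁, and lam·r^{1/3} ≥ s/2 gives c.
  set s : ℝ := s₁ / 2 with hs
  have hs0 : 0 < s := by positivity
  set c : ℝ := g * (s / 2) with hc
  have hc0 : 0 < c := by positivity
  obtain ⟨ε, hε, hcount⟩ := LPP.exists_card_monotoneMaps_le_exp (show 0 < c / 4 by positivity)
  refine ⟨c / 4, by positivity, fun C₃ hC₃ => ?_⟩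
  -- The loss sC₃ak² becomes at most (c/4)a²k²; only a carries the dependence on C₃.
  obtain ⟨a, ha⟩ : ∃ a : ℕ, 4 * s * C₃ / c + 1 ≤ a := exists_nat_ge _
  have ha1 : (1 : ℝ) ≤ a := le_trans (by have : 0 < 4 * s * C₃ / c := by positivity
                                         linarith) ha
  have haC : s * C₃ ≤ c / 4 * a := by
    have : 4 * s * C₃ / c ≤ a := by linarith
    rw [div_le_iff₀ hc0] at this
    linarith
  have ha0 : (0 : ℝ) < a := by linarith
  have haN : 0 < a := by exact_mod_cast ha0
  -- The condition l ≥ Λ, which is k ≤ n/Λ³, makes the blocks longer than r₁ and absorbs the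
  -- rounding of the window and of the cells.
  set Λ : ℝ := 1 + 2 * a ^ 3 * r₁ + 8 * a ^ 2 * (2 / ε + 1) / η with hΛ
  have hΛ1 : 1 + 2 * a ^ 3 * r₁ ≤ Λ := by
    have : 0 ≤ 8 * (a : ℝ) ^ 2 * (2 / ε + 1) / η := by positivity
    linarith
  have hΛ2 : 1 + 8 * a ^ 2 * (2 / ε + 1) / η ≤ Λ := by
    have : 0 ≤ 2 * (a : ℝ) ^ 3 * r₁ := by positivity
    linarith
  have hΛ0 : 1 ≤ Λ := le_trans (le_add_of_nonneg_right (by positivity)) hΛ1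
  -- A window of size δkl² cut into εk cells gives cells of length η(l/a)²/8, half of the bound
  -- needed for h; the other half is left for rounding.
  set δ : ℝ := ε * η / (8 * a ^ 2) with hδ
  refine ⟨δ, 1 / Λ ^ 3, by positivity, by positivity, fun n k hk hkn => ?_⟩
  have hk0 : (0 : ℝ) < k := by exact_mod_cast hk
  have hk1 : (1 : ℝ) ≤ k := by exact_mod_cast hk
  set u : ℝ := (k : ℝ) ^ (1 / 3 : ℝ) with hu
  set v : ℝ := (n : ℝ) ^ (1 / 3 : ℝ) with hv
  have hu0 : 0 < u := by positivity
  have hv0 : 0 ≤ v := by positivity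
  have hu3 : u ^ 3 = k := LPP.rpow_one_third_cube hk0.le
  have hv3 : v ^ 3 = n := LPP.rpow_one_third_cube (Nat.cast_nonneg n)
  have hu2 : (k : ℝ) ^ (2 / 3 : ℝ) = u ^ 2 := LPP.rpow_two_thirds_eq_sq hk0.le
  have hv2 : (n : ℝ) ^ (2 / 3 : ℝ) = v ^ 2 := LPP.rpow_two_thirds_eq_sq (Nat.cast_nonneg n)
  set l : ℝ := v / u with hl
  have hvl : v = l * u := by rw [hl]; field_simp
  have hlΛ : Λ ≤ l := by
    rw [hl, le_div_iff₀ hu0]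
    refine le_of_pow_le_pow_left₀ (n := 3) (by norm_num) hv0 ?_
    rw [mul_pow, hu3, hv3]
    rw [one_div, inv_mul_eq_div, le_div_iff₀ (by positivity)] at hkn
    linarith
  have hl1 : 1 ≤ l := hΛ0.trans hlΛ
  have hl0 : 0 < l := by linarith
  set m : ℕ := a ^ 3 * k with hm
  have hmN : 0 < m := by positivity
  have hmR : (m : ℝ) = a ^ 3 * k := by rw [hm]; push_cast; ring
  have hnm : (n : ℝ) / m = (l / a) ^ 3 := by
    rw [hmR, ← hv3, ← hu3, hvl]; field_simp
  have hnm2 : 2 * r₁ ≤ (n : ℝ) / m := by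
    rw [hnm, div_pow, le_div_iff₀ (by positivity)]
    have : l ≤ l ^ 3 := le_self_pow₀ hl1 (by norm_num)
    linarith
  set t : ℕ → ℕ := fun j => j * n / m with ht
  set N : ℕ := ⌊ε * k⌋₊ + 1 with hN
  have hNε : ε * k ≤ N := by rw [hN]; push_cast; exact (Nat.lt_floor_add_one _).le
  have hN0 : (0 : ℤ) < N := by rw [hN]; positivity
  set W : ℝ := δ * u * (n : ℝ) ^ (2 / 3 : ℝ) with hW
  have hWl : W = δ * k * l ^ 2 := by rw [hW, hv2, hvl, ← hu3]; ring
  set D : ℤ := ⌈W + 1⌉ with hD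
  have hD1 : W + 1 ≤ D := Int.le_ceil _
  have hD2 : (D : ℝ) < W + 2 := by have := Int.ceil_lt_add_one (W + 1); linarith
  have hW0 : 0 ≤ W := by rw [hWl]; positivity
  have hD0 : 0 ≤ D := by
    have : (0 : ℝ) ≤ D := by linarith
    exact_mod_cast this
  set h : ℤ := D / N + 1 with hh
  have hh0 : 0 < h := by have := Int.ediv_nonneg hD0 hN0.le; omega
  have hDN : D < N * h := by rw [hh, mul_comm]; exact Int.lt_ediv_add_one_mul_self D hN0
  have hhle : (h : ℝ) ≤ η * (l / a) ^ 2 / 4 := by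
    have h1 : ((D / N : ℤ) : ℝ) * N ≤ D := by exact_mod_cast Int.ediv_mul_le D hN0.ne'
    have h2 : ((D / N : ℤ) : ℝ) * (ε * k) ≤ W + 2 * k := by
      have : (0 : ℝ) ≤ ((D / N : ℤ) : ℝ) := by exact_mod_cast Int.ediv_nonneg hD0 hN0.le
      have := mul_le_mul_of_nonneg_left hNε this
      linarith
    have h3 : ((D / N : ℤ) : ℝ) ≤ δ / ε * l ^ 2 + 2 / ε := by
      rw [← le_div_iff₀ (by positivity), hWl] at h2
      refine h2.trans (le_of_eq ?_)
      field_simp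
    have h4 : 2 / ε + 1 ≤ η * (l / a) ^ 2 / 8 := by
      have h5 : l ≤ l ^ 2 := le_self_pow₀ hl1 (by norm_num)
      have h6 : 8 * a ^ 2 * (2 / ε + 1) / η ≤ l ^ 2 := by linarith
      rw [div_le_iff₀ hη] at h6
      rw [div_pow, mul_div_assoc', div_div, le_div_iff₀ (by positivity)]
      linarith
    have h7 : δ / ε * l ^ 2 = η * (l / a) ^ 2 / 8 := by rw [hδ]; field_simp
    rw [hh]; push_cast
    linarith
  set lam : ℝ := s * (a / l) with hlam
  have hmain := LPP.measureReal_disjointPathsEvent_le (ν := ν) (μ := μ) (m := m) (N := N) (δ := δ)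
    (C₃ := C₃) hk (t := t) (fun i j hij => Nat.div_le_div_right (Nat.mul_le_mul_right n hij))
    (by simp [ht]) (by simp only [ht]; exact Nat.mul_div_cancel_left n hmN) hh0 hD1 hDN
    (lam := lam) (c := c) (q := c / 4 * k) (by positivity) (hcount k) (by
      intro j _ t₀ α β
      set r : ℕ := t (j + 1) - t j with hr
      obtain ⟨b1, b2⟩ := LPP.div_step_bounds (n := n) hmN j
      change _ ≤ (r : ℝ) at b1
      change (r : ℝ) ≤ _ at b2
      set x : ℝ := (r : ℝ) ^ (1 / 3 : ℝ) with hx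
      have hx3 : x ^ 3 = r := LPP.rpow_one_third_cube (Nat.cast_nonneg r)
      have hx0 : 0 ≤ x := by positivity
      rw [hnm] at b1 b2 hnm2
      have hx1 : l / a / 2 ≤ x := by
        refine le_of_pow_le_pow_left₀ (n := 3) (by norm_num) hx0 ?_
        rw [hx3, div_pow _ 2]; linarith
      have hx2 : x ≤ 2 * (l / a) := by
        refine le_of_pow_le_pow_left₀ (n := 3) (by norm_num) (by positivity) ?_
        rw [hx3, mul_pow]; linarith
      have hla : lam * (l / a) = s := by rw [hlam]; field_simp
      have hlam0 : 0 ≤ lam := by positivity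
      refine (hcross r (by linarith) h hh0.le ?_ lam hlam0 ?_ t₀ α β).trans
        (ENNReal.ofReal_le_ofReal (Real.exp_le_exp.2 ?_))
      · rw [LPP.rpow_two_thirds_eq_sq (Nat.cast_nonneg r), ← hx]
        refine hhle.trans ?_
        calc η * (l / a) ^ 2 / 4 = η * (l / a / 2) ^ 2 := by ring
          _ ≤ η * x ^ 2 := by gcongr
      · calc lam * x ≤ lam * (2 * (l / a)) := by gcongr
          _ = 2 * (lam * (l / a)) := by ring
          _ = s₁ := by rw [hla, hs]; ring
      · have h1 : lam * (l / a / 2) ≤ lam * x := by gcongr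
        have h2 : lam * (l / a / 2) = s / 2 := by rw [← hla]; ring
        have h3 : c ≤ g * (lam * x) := by rw [hc, ← h2]; gcongr
        linarith)
  refine hmain.trans (Real.exp_le_exp.2 ?_)
  have e1 : lam * (k * (C₃ * (k : ℝ) ^ (2 / 3 : ℝ) * (n : ℝ) ^ (1 / 3 : ℝ))) =
      s * C₃ * a * k ^ 2 := by
    rw [hu2, ← hv, hvl, hlam, ← hu3]; field_simp
  rw [e1, hmR]
  -- In units of ck², the exponent is at most a³/2 − a³ + a²/4, which is at most −1/4.
  have e2 : s * C₃ * a * k ^ 2 ≤ c / 4 * a * a * (k : ℝ) ^ 2 := by gcongr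
  have e3 : (a : ℝ) ^ 2 ≤ a ^ 3 := pow_le_pow_right₀ ha1 (by norm_num)
  have e4 : (1 : ℝ) ≤ a ^ 3 := one_le_pow₀ ha1
  have e5 : c * (k : ℝ) ^ 2 * a ^ 2 ≤ c * (k : ℝ) ^ 2 * a ^ 3 := by gcongr
  have e6 : c * (k : ℝ) ^ 2 * 1 ≤ c * (k : ℝ) ^ 2 * a ^ 3 := by gcongr
  linarith
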